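/- Let $n\ge 1$ and let $\Omega\subset\mathbb{R}^n$ be a nonempty, open, bounded and convex set. Let $A:\Omega\to\mathbb{R}^{n\times n}$ be Lipschitz continuous, symmetric and uniformly positive definite, let $0\le c\in L^\infty(\Omega)$, and let $\mathcal{L}w=-\operatorname{div}(A\nabla w)+cw$, supplemented with homogeneous Dirichlet boundary conditions. Then there are eigenpairs $(\lambda_k,\varphi_k)_{k\in\mathbb N}\subset\mathbb{R}_+\times H^1_0(\Omega)$ of $\mathcal{L}$, i.e. $\int_\Omega (A\nabla\varphi_k\cdot\nabla v+c\varphi_k v)=\lambda_k\int_\Omega\varphi_k v$ for all $v\in H_0^1(\Omega)$, such that $(\varphi_k)$ is an orthonormal basis of $L^2(\Omega)$. For any such eigenpairs and $s\ge 0$, write $w_k=(w,\varphi_k)_{L^2(\Omega)}$ and let $\mathbb{H}^s(\Omega)$ be the space of $w\in L^2(\Omega)$ with $\|w\|_{\mathbb{H}^s(\Omega)}^2:=\sum_k\lambda_k^s|w_k|^2<\infty$, let $\mathbb{H}^{-s}(\Omega)$ be its dual, with duality pairing $\langle\cdot,\cdot\rangle$ extending the inner product of $L^2(\Omega)$, and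 let $\mathcal{L}^s:\mathbb{H}^s(\Omega)\to\mathbb{H}^{-s}(\Omega)$ be given by $\langle\mathcal{L}^sw,v\rangle=\sum_k\lambda_k^sw_kv_k$. Let $s\in(0,1)$ and $T>0$. There is a constant $C>0$, depending only on $\Omega,A,c,s,T$, such that the following holds for all $f\in L^2(0,T;L^2(\Omega))$, $g\in\mathbb{H}^s(\Omega)$ and $h\in L^2(\Omega)$. The problem $\partial_t^2u+\mathcal{L}^su=f$ in $\Omega\times(0,T)$, $u(0)=g$, $\partial_tu(0)=h$ has a unique weak solution, that is, there is exactly one $u\in L^2(0,T;\mathbb{H}^s(\Omega))$ with distributional time derivatives $\partial_tu\in L^2(0,T;L^2(\Omega))$ and $\partial_t^2u\in L^2(0,T;\mathbb{H}^{-s}(\Omega))$ such that $u(0)=g$, $\partial_tu(0)=h$ (in the sense of the continuous representatives $u\in C([0,T];L^2(\Omega))$ and $\partial_tu\in C([0,T];\mathbb{H}^{-s}(\Omega))$) and, for a.e. $t\in(0,T)$, $$\langle\partial_t^2u(t),v\rangle+\langle\mathcal{L}^su(t),v\rangle=\langle f(t),v\rangle\qquad\forall v\in\mathbb{H}^s(\Omega).$$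 Moreover, $$\|u\|_{L^\infty(0,T;\mathbb{H}^s(\Omega))}+\|\partial_tu\|_{L^\infty(0,T;L^2(\Omega))}\le C\left(\|f\|_{L^2(0,T;L^2(\Omega))}+\|g\|_{\mathbb{H}^s(\Omega)}+\|h\|_{L^2(\Omega)}\right).$$ -/

import Mathlib

open MeasureTheory Set Filter Topology
open scoped ENNReal NNReal ContDiff

noncomputable section

namespace FracWave

/-- Data of the elliptic operator `𝓛 w = -div (A ∇w) + c w` with homogeneous Dirichlet conditions:
a nonempty open bounded convex `Ω ⊆ ℝⁿ`, `n ≥ 1`, a Lipschitz, symmetric, uniformly positive definite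
matrix field `A` on `Ω`, and a nonnegative `c ∈ L^∞(Ω)`. Values outside `Ω` are irrelevant. -/
structure EllipticOperator (n : ℕ) where
  /-- The domain `Ω`. -/
  Ω : Set (EuclideanSpace ℝ (Fin n))
  /-- The diffusion matrix. -/
  A : EuclideanSpace ℝ (Fin n) → Matrix (Fin n) (Fin n) ℝ
  /-- The reaction coefficient. -/
  c : EuclideanSpace ℝ (Fin n) → ℝ
  one_le_dim : 1 ≤ n
  isOpen : IsOpen Ω
  nonempty : Ω.Nonempty
  bounded : Bornology.IsBounded Ω
  convex : Convex ℝ Ω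
  lipschitz : ∃ K : ℝ≥0, ∀ i j, LipschitzOnWith K (fun x => A x i j) Ω
  symmetric : ∀ x ∈ Ω, (A x).IsSymm
  elliptic : ∃ α > 0, ∀ x ∈ Ω, ∀ ξ : EuclideanSpace ℝ (Fin n),
    α * ‖ξ‖ ^ 2 ≤ ∑ i, ∑ j, A x i j * ξ j * ξ i
  c_memLp : MemLp c ∞ (volume.restrict Ω)
  c_nonneg : ∀ᵐ x ∂volume.restrict Ω, 0 ≤ c x

variable {n : ℕ}

/-- `L²(Ω)`. -/
abbrev L2 (P : EllipticOperator n) : Type := Lp ℝ 2 (volume.restrict P.Ω)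

/-- `L²(Ω; ℝⁿ)`. -/
abbrev L2Vec (P : EllipticOperator n) : Type :=
  Lp (EuclideanSpace ℝ (Fin n)) 2 (volume.restrict P.Ω)

/-- The pairs `(φ, ∇φ)` with `φ ∈ C_c^∞(Ω)`. -/
def testPairs (P : EllipticOperator n) : Set (L2 P × L2Vec P) :=
  {p | ∃ φ : EuclideanSpace ℝ (Fin n) → ℝ, ContDiff ℝ ∞ φ ∧ HasCompactSupport φ ∧
    tsupport φ ⊆ P.Ω ∧ p.1 =ᵐ[volume.restrict P.Ω] φ ∧ p.2 =ᵐ[volume.restrict P.Ω] gradient φ}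

/-- `H¹₀(Ω)`, the closure of `C_c^∞(Ω)` in the `H¹` norm, as the set of pairs `(w, ∇w)` of a
function of `H¹₀(Ω)` and its weak gradient. -/
def H10 (P : EllipticOperator n) : Set (L2 P × L2Vec P) := closure (testPairs P)

/-- The bilinear form `∫_Ω A∇w·∇v + c w v` of `𝓛`, on pairs (function, gradient). -/
def form (P : EllipticOperator n) (p q : L2 P × L2Vec P) : ℝ :=
  ∫ x in P.Ω, ((∑ i, ∑ j, P.A x i j * p.2 x j * q.2 x i) + P.c x * p.1 x * q.1 x)

/-- `φ ∈ H¹₀(Ω) \ {0}` and `𝓛 φ = lam φ` in `Ω`, in the weak sense. -/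
def IsEigenpair (P : EllipticOperator n) (lam : ℝ) (φ : L2 P) : Prop :=
  φ ≠ 0 ∧ ∃ G : L2Vec P, (φ, G) ∈ H10 P ∧ ∀ q ∈ H10 P, form P (φ, G) q = lam * inner ℝ φ q.1

/-- A countable collection of eigenpairs of `𝓛` whose eigenfunctions form an orthonormal basis
of `L²(Ω)`. -/
structure Eigenbasis (P : EllipticOperator n) where
  /-- The eigenvalues. -/
  eigval : ℕ → ℝ
  /-- The orthonormal basis of eigenfunctions. -/
  basis : HilbertBasis ℕ ℝ (L2 P)
  isEigenpair : ∀ k, IsEigenpair P (eigval k) (basis k)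

/-! ### The eigenvalues are bounded below by a positive constant -/

theorem norm_sq_eq_integral {E F : Type*} [MeasurableSpace E] {μ : Measure E}
    [NormedAddCommGroup F] [InnerProductSpace ℝ F] (w : Lp F 2 μ) :
    ‖w‖ ^ 2 = ∫ x, ‖w x‖ ^ 2 ∂μ := by
  rw [← real_inner_self_eq_norm_sq, L2.inner_def]
  simp only [real_inner_self_eq_norm_sq]

theorem integral_sq_le_of_test (P : EllipticOperator n) {R : ℝ} (hR : 0 < R)
    (hΩ : ∀ x ∈ P.Ω, ‖x‖ ≤ R) {φ : EuclideanSpace ℝ (Fin n) → ℝ} (hφ : ContDiff ℝ ∞ φ)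
    (hc : HasCompactSupport φ) (hsupp : tsupport φ ⊆ P.Ω) :
    ∫ x in P.Ω, φ x ^ 2 ≤ 4 * R ^ 2 * ∫ x in P.Ω, ‖gradient φ x‖ ^ 2 := by
  have hd : Differentiable ℝ φ := hφ.differentiable (by simp)
  have hgc : Continuous (gradient φ) := by
    unfold gradient
    exact (LinearIsometryEquiv.continuous _).comp (hφ.continuous_fderiv (by simp))
  have hgs : HasCompactSupport (gradient φ) := by
    have h1 := hc.fderiv (𝕜 := ℝ)
    exact h1.comp_left (g := (InnerProductSpace.toDual ℝ _).symm) (map_zero _)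
  have hgz : ∀ x, x ∉ P.Ω → gradient φ x = 0 := fun x hx => by
    have : fderiv ℝ φ x = 0 := by
      by_contra h
      exact hx (hsupp (support_fderiv_subset ℝ h))
    simp [gradient, this]
  have hφz : ∀ x, x ∉ P.Ω → φ x = 0 := fun x hx => by
    by_contra h
    exact hx (hsupp (subset_tsupport _ h))
  have e1 : ∫ x in P.Ω, φ x ^ 2 = ∫ x, φ x ^ 2 :=
    setIntegral_eq_integral_of_forall_compl_eq_zero fun x hx => by simp [hφz x hx]
  have e2 : ∫ x in P.Ω, ‖gradient φ x‖ ^ 2 = ∫ x, ‖gradient φ x‖ ^ 2 :=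
    setIntegral_eq_integral_of_forall_compl_eq_zero fun x hx => by simp [hgz x hx]
  have hsq : HasCompactSupport fun x => φ x ^ 2 := by
    simp only [sq]
    exact hc.mul_left
  have i1 : Integrable fun x => φ x ^ 2 :=
    (hφ.continuous.pow 2).integrable_of_hasCompactSupport hsq
  have i2 : Integrable fun x => ‖gradient φ x‖ ^ 2 :=
    (hgc.norm.pow 2).integrable_of_hasCompactSupport
      (by
        simp only [sq]
        exact hgs.norm.mul_left)
  obtain ⟨ℓ, v, hℓ, hℓv, hv⟩ : ∃ (ℓ : EuclideanSpace ℝ (Fin n) →L[ℝ] ℝ)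
      (v : EuclideanSpace ℝ (Fin n)), (∀ x, |ℓ x| ≤ ‖x‖) ∧ ℓ v = 1 ∧ ‖v‖ = 1 :=
    ⟨EuclideanSpace.proj ⟨0, P.one_le_dim⟩, EuclideanSpace.single ⟨0, P.one_le_dim⟩ 1,
      fun x => PiLp.norm_apply_le x _, by simp, by simp⟩
  have hdsq : ∀ x, fderiv ℝ (fun y => φ y ^ 2) x v = 2 * φ x * inner ℝ (gradient φ x) v := by
    intro x
    rw [fderiv_fun_pow _ (hd x)]
    simp [gradient]
  have i3 : Integrable fun x => ℓ x * fderiv ℝ (fun y => φ y ^ 2) x v := by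
    simp only [hdsq]
    refine Continuous.integrable_of_hasCompactSupport ?_ ?_
    · have := hφ.continuous
      fun_prop
    · refine HasCompactSupport.mul_left (HasCompactSupport.mul_right ?_)
      exact hc.mul_left
  have ibp := integral_mul_fderiv_eq_neg_fderiv_mul_of_integrable (μ := volume)
    (f := fun x => ℓ x) (g := fun x => φ x ^ 2) (v := v)
    (by simpa [hℓv] using i1) i3
    ((ℓ.continuous.mul (hφ.continuous.pow 2)).integrable_of_hasCompactSupport
      hsq.mul_left)
    (fun x _ => ℓ.differentiableAt) (fun x _ => (hd x).pow 2)
  simp only [ContinuousLinearMap.fderiv, hℓv, one_mul] at ibp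
  have key : ∫ x, φ x ^ 2 ≤ ∫ x, (φ x ^ 2 / 2 + 2 * R ^ 2 * ‖gradient φ x‖ ^ 2) := by
    rw [← neg_eq_iff_eq_neg.mpr ibp, ← integral_neg]
    refine integral_mono i3.neg ((i1.div_const 2).add (i2.const_mul _)) fun x => ?_
    simp only [hdsq]
    by_cases hx : x ∈ P.Ω
    · have h1 : |ℓ x| ≤ R := (hℓ x).trans (hΩ x hx)
      have h2 : |inner ℝ (gradient φ x) v| ≤ ‖gradient φ x‖ := by
        simpa [hv] using abs_real_inner_le_norm (gradient φ x) v
      have h3 : |ℓ x * inner ℝ (gradient φ x) v| ≤ R * ‖gradient φ x‖ := by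
        rw [abs_mul]
        gcongr
      have h4 := sq_le_sq' (by linarith [neg_abs_le (ℓ x * inner ℝ (gradient φ x) v)])
        ((le_abs_self _).trans h3)
      nlinarith [sq_nonneg (φ x + 2 * (ℓ x * inner ℝ (gradient φ x) v))]
    · simp [hφz x hx]
      positivity
  rw [integral_add (i1.div_const 2) (i2.const_mul _), integral_div, integral_const_mul] at key
  rw [e1, e2]
  linarith

theorem poincare (P : EllipticOperator n) :
    ∃ K > 0, ∀ p ∈ H10 P, ‖p.1‖ ^ 2 ≤ K * ‖p.2‖ ^ 2 := by
  obtain ⟨R, hR, hΩ⟩ := P.bounded.exists_pos_norm_le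
  refine ⟨4 * R ^ 2, by positivity, fun p hp => ?_⟩
  have hcl : IsClosed {p : L2 P × L2Vec P | ‖p.1‖ ^ 2 ≤ 4 * R ^ 2 * ‖p.2‖ ^ 2} :=
    isClosed_le (by fun_prop) (by fun_prop)
  refine closure_minimal ?_ hcl hp
  intro q hq
  obtain ⟨φ, hφ, hc, hsupp, hw, hG⟩ := hq
  have h := integral_sq_le_of_test P hR hΩ hφ hc hsupp
  have e1 : ‖q.1‖ ^ 2 = ∫ x in P.Ω, φ x ^ 2 := by
    rw [norm_sq_eq_integral]
    refine integral_congr_ae ?_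
    filter_upwards [hw] with x hx
    simp [hx]
  have e2 : ‖q.2‖ ^ 2 = ∫ x in P.Ω, ‖gradient φ x‖ ^ 2 := by
    rw [norm_sq_eq_integral]
    refine integral_congr_ae ?_
    filter_upwards [hG] with x hx
    simp [hx]
  change ‖q.1‖ ^ 2 ≤ 4 * R ^ 2 * ‖q.2‖ ^ 2
  rw [e1, e2]
  exact h

theorem form_coercive (P : EllipticOperator n) :
    ∃ α > 0, ∀ p : L2 P × L2Vec P, α * ‖p.2‖ ^ 2 ≤ form P p p := by
  obtain ⟨α, hα, hell⟩ := P.elliptic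
  obtain ⟨K, hK⟩ := P.lipschitz
  refine ⟨α, hα, fun p => ?_⟩
  have hmeas := P.isOpen.measurableSet
  have hcomp : ∀ i, MemLp (fun x => p.2 x i) 2 (volume.restrict P.Ω) := fun i =>
    (EuclideanSpace.proj (𝕜 := ℝ) i).comp_memLp' (Lp.memLp p.2)
  have hA : ∀ i j, MemLp (fun x => P.A x i j) ∞ (volume.restrict P.Ω) := fun i j => by
    obtain ⟨x₀, hx₀⟩ := P.nonempty
    obtain ⟨D, hD⟩ := P.bounded.exists_norm_le
    refine memLp_top_of_bound ((hK i j).continuousOn.aestronglyMeasurable hmeas)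
      (‖P.A x₀ i j‖ + K * (D + D)) ?_
    filter_upwards [ae_restrict_mem hmeas] with x hx
    have h1 := (hK i j).norm_sub_le hx hx₀
    have h2 : ‖x - x₀‖ ≤ D + D := (norm_sub_le _ _).trans (add_le_add (hD x hx) (hD x₀ hx₀))
    have h3 := norm_le_norm_add_norm_sub' (P.A x i j) (P.A x₀ i j)
    have h4 := mul_le_mul_of_nonneg_left h2 K.2
    exact h3.trans (add_le_add le_rfl (h1.trans h4))
  have i1 : Integrable (fun x => ∑ i, ∑ j, P.A x i j * p.2 x j * p.2 x i)
      (volume.restrict P.Ω) := by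
    refine integrable_finsetSum _ fun i _ => integrable_finsetSum _ fun j _ => ?_
    have h1 : MemLp (fun x => P.A x i j * p.2 x j) 2 (volume.restrict P.Ω) :=
      (hcomp j).mul (hA i j)
    exact h1.integrable_mul (hcomp i)
  have i2 : Integrable (fun x => P.c x * p.1 x * p.1 x) (volume.restrict P.Ω) := by
    have h1 : MemLp (fun x => P.c x * p.1 x) 2 (volume.restrict P.Ω) :=
      (Lp.memLp p.1).mul P.c_memLp
    exact h1.integrable_mul (Lp.memLp p.1)
  have i3 : Integrable (fun x => ‖p.2 x‖ ^ 2) (volume.restrict P.Ω) :=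
    (Lp.memLp p.2).integrable_norm_pow (by simp)
  rw [norm_sq_eq_integral, ← integral_const_mul, form]
  refine integral_mono_ae (i3.const_mul α) (i1.add i2) ?_
  filter_upwards [ae_restrict_mem hmeas, P.c_nonneg] with x hx hcx
  have h1 := hell x hx (p.2 x)
  have h2 : 0 ≤ P.c x * p.1 x * p.1 x := by
    rw [mul_assoc]
    exact mul_nonneg hcx (mul_self_nonneg _)
  exact h1.trans (le_add_of_nonneg_right h2)

namespace Eigenbasis

variable {P : EllipticOperator n} (B : Eigenbasis P)

theorem exists_le_eigval : ∃ m > 0, ∀ k, m ≤ B.eigval k := by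
  obtain ⟨K, hK, hP⟩ := poincare P
  obtain ⟨α, hα, hc⟩ := form_coercive P
  refine ⟨α / K, by positivity, fun k => ?_⟩
  obtain ⟨-, G, hG, h⟩ := B.isEigenpair k
  have h1 := h _ hG
  have h2 := hc (B.basis k, G)
  have h3 := hP _ hG
  have h4 : ‖B.basis k‖ = 1 := B.basis.orthonormal.1 k
  rw [h1, real_inner_self_eq_norm_sq, h4] at h2
  simp only [h4] at h3
  rw [div_le_iff₀ hK]
  nlinarith

theorem eigval_pos (k : ℕ) : 0 < B.eigval k := by
  obtain ⟨m, hm, h⟩ := B.exists_le_eigval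
  exact hm.trans_le (h k)

/-- The coefficient `w_k = (w, φ_k)`. -/
def coeff (w : L2 P) (k : ℕ) : ℝ := inner ℝ (B.basis k) w

theorem coeff_add (v w : L2 P) (k : ℕ) : B.coeff (v + w) k = B.coeff v k + B.coeff w k :=
  inner_add_right _ _ _

theorem coeff_smul (a : ℝ) (w : L2 P) (k : ℕ) : B.coeff (a • w) k = a * B.coeff w k :=
  real_inner_smul_right _ _ _

theorem hasSum_coeff_sq (w : L2 P) : HasSum (fun k => B.coeff w k ^ 2) (‖w‖ ^ 2) := by
  have h := B.basis.hasSum_inner_mul_inner w w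
  rw [real_inner_self_eq_norm_sq] at h
  have e : (fun k => B.coeff w k ^ 2) =
      fun k => inner ℝ w (B.basis k) * inner ℝ (B.basis k) w := by
    funext k
    rw [sq, coeff, real_inner_comm w]
  rw [e]
  exact h

/-- `ℍ^s(Ω)` as a subspace of `L²(Ω)`: all `w = ∑ w_k φ_k` with `∑ λ_k^s |w_k|² < ∞`. -/
def HsSub (s : ℝ≥0) : Submodule ℝ (L2 P) where
  carrier := {w | Summable fun k => B.eigval k ^ (s : ℝ) * B.coeff w k ^ 2}
  zero_mem' := by simp [coeff, summable_zero]
  add_mem' := by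
    intro v w hv hw
    refine Summable.of_nonneg_of_le (fun k => ?_) (fun k => ?_) ((hv.add hw).mul_left 2)
    · have := (B.eigval_pos k).le
      positivity
    · have := Real.rpow_nonneg (B.eigval_pos k).le s
      rw [coeff_add]
      nlinarith [mul_nonneg this (sq_nonneg (B.coeff v k - B.coeff w k))]
  smul_mem' := by
    intro a w hw
    refine (Summable.mul_left (a ^ 2) hw).congr fun k => ?_
    rw [coeff_smul]
    ring

/-- `ℍ^s(Ω)`, `s ≥ 0`, with the norm `‖w‖² = ∑ λ_k^s |w_k|²`; see `Hs.norm_sq_eq`. -/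
def Hs (s : ℝ≥0) : Type := B.HsSub s

namespace Hs

variable {B} {s : ℝ≥0}

instance : AddCommGroup (B.Hs s) := inferInstanceAs (AddCommGroup (B.HsSub s))

instance : Module ℝ (B.Hs s) := inferInstanceAs (Module ℝ (B.HsSub s))

variable (B s)

/-- The inclusion of `ℍ^s(Ω)` in `L²(Ω)`, as a linear map. -/
def incl : B.Hs s →ₗ[ℝ] L2 P := (B.HsSub s).subtype

theorem incl_injective : Function.Injective (incl B s) := Subtype.val_injective

/-- The map `w ↦ (λ_k^{s/2} w_k)_k` from `ℍ^s(Ω)` to `ℓ²`. -/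
def toSeq : B.Hs s →ₗ[ℝ] lp (fun _ : ℕ => ℝ) 2 where
  toFun w := ⟨fun k => B.eigval k ^ ((s : ℝ) / 2) * B.coeff (incl B s w) k, by
    have hw : Summable fun k => B.eigval k ^ (s : ℝ) * B.coeff (incl B s w) k ^ 2 := w.2
    refine memℓp_gen (hw.congr fun k => ?_)
    have h := B.eigval_pos k
    simp only [ENNReal.toReal_ofNat, Real.rpow_two, Real.norm_eq_abs, sq_abs]
    rw [mul_pow, ← Real.rpow_natCast (B.eigval k ^ ((s : ℝ) / 2)), ← Real.rpow_mul h.le]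
    norm_num⟩
  map_add' v w := by
    ext k
    simp only [map_add, coeff_add, mul_add]
    rfl
  map_smul' a w := by
    ext k
    simp [coeff_smul]
    ring

theorem toSeq_apply (w : B.Hs s) (k : ℕ) :
    toSeq B s w k = B.eigval k ^ ((s : ℝ) / 2) * B.coeff (incl B s w) k := rfl

theorem toSeq_injective : Function.Injective (toSeq B s) := by
  rw [injective_iff_map_eq_zero]
  intro w hw
  apply incl_injective B s
  rw [map_zero]
  have h0 : ∀ k, B.coeff (incl B s w) k = 0 := fun k => by
    have h := congrArg (fun x : lp (fun _ : ℕ => ℝ) 2 => x k) hw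
    have hp := Real.rpow_pos_of_pos (B.eigval_pos k) ((s : ℝ) / 2)
    simpa [toSeq_apply, hp.ne'] using h
  have h := B.hasSum_coeff_sq (incl B s w)
  simp only [h0] at h
  have h2 := h.unique (a₂ := 0) (by simp only [sq, mul_zero]; exact hasSum_zero)
  simpa using h2

instance : NormedAddCommGroup (B.Hs s) :=
  NormedAddCommGroup.induced (B.Hs s) (lp (fun _ : ℕ => ℝ) 2) (toSeq B s) (toSeq_injective B s)

instance : NormedSpace ℝ (B.Hs s) := NormedSpace.induced ℝ (B.Hs s) _ (toSeq B s)

theorem norm_toSeq (w : B.Hs s) : ‖toSeq B s w‖ = ‖w‖ := rfl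

theorem hasSum_inner_toSeq (v w : B.Hs s) :
    HasSum (fun k => B.eigval k ^ (s : ℝ) * B.coeff (incl B s v) k * B.coeff (incl B s w) k)
      (inner ℝ (toSeq B s v) (toSeq B s w)) := by
  have H := lp.hasSum_inner (𝕜 := ℝ) (toSeq B s v) (toSeq B s w)
  have e : (fun k => inner ℝ (toSeq B s v k) (toSeq B s w k)) = fun k =>
      B.eigval k ^ (s : ℝ) * B.coeff (incl B s v) k * B.coeff (incl B s w) k := by
    funext k
    have h : B.eigval k ^ (s : ℝ) =
        B.eigval k ^ ((s : ℝ) / 2) * B.eigval k ^ ((s : ℝ) / 2) := by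
      rw [← Real.rpow_add (B.eigval_pos k), add_halves]
    simp only [toSeq_apply, h, RCLike.inner_apply, conj_trivial]
    ring
  rwa [e] at H

theorem norm_sq_eq (w : B.Hs s) :
    ‖w‖ ^ 2 = ∑' k, B.eigval k ^ (s : ℝ) * B.coeff (incl B s w) k ^ 2 := by
  rw [← norm_toSeq, ← real_inner_self_eq_norm_sq, ← (hasSum_inner_toSeq B s w w).tsum_eq]
  simp only [sq, mul_assoc]

/-- The continuous embedding `ℍ^s(Ω) ↪ L²(Ω)`. -/
def toL2 : B.Hs s →L[ℝ] L2 P :=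
  ⟨incl B s, by
    obtain ⟨m, hm, h⟩ := B.exists_le_eigval
    have hms : 0 < m ^ (s : ℝ) := Real.rpow_pos_of_pos hm _
    refine AddMonoidHomClass.continuous_of_bound (incl B s) (√((m ^ (s : ℝ))⁻¹)) fun w => ?_
    have h1 := (B.hasSum_coeff_sq (incl B s w)).mul_left (m ^ (s : ℝ))
    have h2 := hasSum_inner_toSeq B s w w
    have h3 := hasSum_le (fun k => ?_) h1 h2
    · rw [real_inner_self_eq_norm_sq, norm_toSeq] at h3
      refine abs_le_of_sq_le_sq' ?_ (by positivity) |>.2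
      rw [mul_pow, Real.sq_sqrt (by positivity), inv_mul_eq_div, le_div_iff₀ hms]
      linarith
    · rw [sq, mul_assoc]
      exact mul_le_mul_of_nonneg_right (Real.rpow_le_rpow hm.le (h k) s.2)
        (mul_self_nonneg _)⟩

/-- `ℍ^{-s}(Ω)`, the dual of `ℍ^s(Ω)`. -/
abbrev Dual : Type := StrongDual ℝ (B.Hs s)

/-- The embedding `L²(Ω) ↪ ℍ^{-s}(Ω)`, `⟨f, v⟩ = (f, v)_{L²(Ω)}`. -/
def ofL2 : L2 P →L[ℝ] Dual B s :=
  (innerSL ℝ : L2 P →L[ℝ] L2 P →L[ℝ] ℝ).bilinearComp (.id ℝ (L2 P)) (toL2 B s)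

theorem ofL2_apply (f : L2 P) (v : B.Hs s) : ofL2 B s f v = inner ℝ f (toL2 B s v) := rfl

/-- The isometric embedding `toSeq` as a continuous linear map. -/
def toSeqL : B.Hs s →L[ℝ] lp (fun _ : ℕ => ℝ) 2 :=
  ⟨toSeq B s, AddMonoidHomClass.continuous_of_bound (toSeq B s) 1 fun w => by
    rw [norm_toSeq, one_mul]⟩

/-- The spectral fractional power `𝓛^s : ℍ^s(Ω) → ℍ^{-s}(Ω)`, `𝓛^s w = ∑ λ_k^s w_k φ_k`, that is,
`⟨𝓛^s w, v⟩ = ∑ λ_k^s w_k v_k`; see `fracPow_apply`. -/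
def fracPow : B.Hs s →L[ℝ] Dual B s :=
  (innerSL ℝ : lp (fun _ : ℕ => ℝ) 2 →L[ℝ] lp (fun _ : ℕ => ℝ) 2 →L[ℝ] ℝ).bilinearComp
    (toSeqL B s) (toSeqL B s)

theorem fracPow_apply (w v : B.Hs s) : fracPow B s w v =
    ∑' k, B.eigval k ^ (s : ℝ) * B.coeff (toL2 B s w) k * B.coeff (toL2 B s v) k :=
  (hasSum_inner_toSeq B s w v).tsum_eq.symm

end Hs

end Eigenbasis

/-! ### Functions of time -/

/-- Lebesgue measure on `(0, T)`. -/
def timeMeasure (T : ℝ) : Measure ℝ := volume.restrict (Ioo 0 T)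

/-- `w` is the distributional derivative of `u` on `(0, T)`. -/
def HasWeakTimeDeriv {X : Type*} [NormedAddCommGroup X] [NormedSpace ℝ X] (T : ℝ)
    (u w : ℝ → X) : Prop :=
  ∀ φ : ℝ → ℝ, ContDiff ℝ ∞ φ → HasCompactSupport φ → tsupport φ ⊆ Ioo 0 T →
    ∫ t, deriv φ t • u t ∂timeMeasure T = -∫ t, φ t • w t ∂timeMeasure T

/-- `u` has a representative in `C([0, T]; X)` whose value at `0` is `x`. -/
def HasInitialValue {X : Type*} [TopologicalSpace X] (T : ℝ) (u : ℝ → X) (x : X) : Prop :=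
  ∃ v : ℝ → X, ContinuousOn v (Icc 0 T) ∧ u =ᵐ[timeMeasure T] v ∧ v 0 = x

open Eigenbasis.Hs in
/-- `u ∈ L²(0,T;ℍ^s(Ω))`, with `u' = ∂_t u ∈ L²(0,T;L²(Ω))` and
`u'' = ∂_t² u ∈ L²(0,T;ℍ^{-s}(Ω))`, is a weak solution of
`∂_t² u + 𝓛^s u = f`, `u(0) = g`, `∂_t u(0) = h`. The initial values are those of the continuous
representatives `u ∈ C([0,T];L²(Ω))` and `∂_t u ∈ C([0,T];ℍ^{-s}(Ω))`. -/
def IsWeakSolution {P : EllipticOperator n} (B : Eigenbasis P) (s : ℝ≥0) (T : ℝ)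
    (f : Lp (L2 P) 2 (timeMeasure T)) (g : B.Hs s) (h : L2 P)
    (u : Lp (B.Hs s) 2 (timeMeasure T)) : Prop :=
  ∃ (u' : Lp (L2 P) 2 (timeMeasure T)) (u'' : Lp (Dual B s) 2 (timeMeasure T)),
    HasWeakTimeDeriv T (fun t => toL2 B s (u t)) u' ∧
    HasWeakTimeDeriv T (fun t => ofL2 B s (u' t)) u'' ∧
    HasInitialValue T (fun t => toL2 B s (u t)) (toL2 B s g) ∧
    HasInitialValue T (fun t => ofL2 B s (u' t)) (ofL2 B s h) ∧
    ∀ᵐ t ∂timeMeasure T, ∀ v : B.Hs s,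
      u'' t v + fracPow B s (u t) v = ofL2 B s (f t) v

end FracWave

end

noncomputable section

namespace FracWave

variable {n : ℕ}

/-! In the coordinates of an eigenbasis the equation decouples into scalar oscillators `v'' + μ v =
f_k` with `μ = λ_k^s > 0`, so everything rests on two facts: such a basis exists, and the
oscillators obey an energy bound that is uniform in `μ` and can be summed over `k`.

Existence of the basis. The form of `𝓛` is bounded and symmetric on `H¹₀(Ω)`, and coercive by
ellipticity and the Poincaré inequality. Lax–Milgram therefore yields a solution operator `R : L²(Ω)
→ H¹₀(Ω)`. Composed with the inclusion it becomes a symmetric operator on `L²(Ω)`, injective because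
test functions are dense and compact by Rellich's theorem (`isCompactOperator_H10Incl`). Rellich is
obtained by approximating the inclusion in operator norm by averages over finitely many cells of a
fine grid. The spectral theorem then gives eigenvectors with eigenvalues `μ_k ≠ 0`
(`exists_hilbertBasis_eigenvectors`), and `λ_k = 1/μ_k` (`nonempty_eigenbasis`).

Wave equation. For a scalar mode, the maximum over `[0, T]` of the energy `w² + μ v²`, `w = v'`, is
at most `2(h² + μ g²) + 4T ∫ f²` (`IsOscillation.energy_le`), with constants free of `μ`. By
Parseval the sum of these bounds over the modes is finite, so the modes assemble into continuous
curves `U` in `ℍ^s(Ω)` and `W` in `L²(Ω)` (`Eigenbasis.exists_oscillation`), and `U` is a weak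
solution with derivative `W`. Conversely, testing any weak solution against an eigenfunction shows
that its coefficients are oscillations with the same data. Scalar uniqueness then forces it to equal
`U` almost everywhere (`IsWeakSolution.ae_eq`). This gives uniqueness, and transfers the bounds on
`U` and `W` to every weak solution. -/

/-! ### The scalar oscillator -/

/-- The product rule for primitives of integrable functions, in integrated form. -/
theorem integral_mul_primitive_add {q r : ℝ → ℝ} {T : ℝ}
    (hq : IntervalIntegrable q volume 0 T) (hr : IntervalIntegrable r volume 0 T) (a b : ℝ) :
    ∫ x in (0 : ℝ)..T, (q x * (b + ∫ y in (0 : ℝ)..x, r y) + (a + ∫ y in (0 : ℝ)..x, q y) * r x) =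
      (a + ∫ y in (0 : ℝ)..T, q y) * (b + ∫ y in (0 : ℝ)..T, r y) - a * b := by
  have hconst : ∀ c : ℝ, AbsolutelyContinuousOnInterval (fun _ => c) 0 T := fun c =>
    (LipschitzWith.const c).lipschitzOnWith.absolutelyContinuousOnInterval
  have hQ : AbsolutelyContinuousOnInterval (fun x => a + ∫ y in (0 : ℝ)..x, q y) 0 T :=
    (hconst a).add (hq.absolutelyContinuousOnInterval_intervalIntegral left_mem_uIcc)
  have hR : AbsolutelyContinuousOnInterval (fun x => b + ∫ y in (0 : ℝ)..x, r y) 0 T :=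
    (hconst b).add (hr.absolutelyContinuousOnInterval_intervalIntegral left_mem_uIcc)
  have h := hQ.integral_deriv_mul_eq_sub hR
  simp only [intervalIntegral.integral_same, add_zero] at h
  rw [← h]
  refine intervalIntegral.integral_congr_ae ?_
  filter_upwards [hq.ae_hasDerivAt_integral, hr.ae_hasDerivAt_integral] with x h1 h2 hx
  have hx' := uIoc_subset_uIcc hx
  rw [((h1 hx' 0 left_mem_uIcc).const_add a).deriv, ((h2 hx' 0 left_mem_uIcc).const_add b).deriv]

/-- `v` solves `v'' + μ v = f`, `v(0) = g`, `v'(0) = h` on `[0, T]` with `w = v'`,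
in integrated form. -/
structure IsOscillation (T μ : ℝ) (f : ℝ → ℝ) (g h : ℝ) (v w : ℝ → ℝ) : Prop where
  continuousOn_fst : ContinuousOn v (Icc 0 T)
  continuousOn_snd : ContinuousOn w (Icc 0 T)
  fst_eq : ∀ t ∈ Icc 0 T, v t = g + ∫ τ in (0 : ℝ)..t, w τ
  snd_eq : ∀ t ∈ Icc 0 T, w t = h + ∫ τ in (0 : ℝ)..t, (f τ - μ * v τ)

namespace IsOscillation

variable {T μ g h : ℝ} {f v w : ℝ → ℝ}

/-- Multiply `v'' + μ v = f` by `2 v'` and integrate. As `f` is merely integrable, `w` is only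
absolutely continuous, so the derivatives of `v²` and `w²` are handled by the integrated product
rule, applied to each primitive with itself. -/
theorem energy_eq (H : IsOscillation T μ f g h v w) (hf : IntervalIntegrable f volume 0 T)
    {t : ℝ} (ht : t ∈ Icc 0 T) :
    w t ^ 2 + μ * v t ^ 2 = h ^ 2 + μ * g ^ 2 + 2 * ∫ τ in (0 : ℝ)..t, f τ * w τ := by
  have hsub : uIcc 0 t ⊆ Icc 0 T := by
    rw [uIcc_of_le ht.1]
    exact Icc_subset_Icc_right ht.2
  have hsub' : uIcc 0 t ⊆ uIcc 0 T := by
    rwa [uIcc_of_le (ht.1.trans ht.2)]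
  have hv := H.continuousOn_fst.mono hsub
  have hw := H.continuousOn_snd.mono hsub
  have iv := hv.intervalIntegrable (μ := volume)
  have iw := hw.intervalIntegrable (μ := volume)
  have jf := hf.mono_set hsub'
  have iq : IntervalIntegrable (fun τ => f τ - μ * v τ) volume 0 t := jf.sub (iv.const_mul μ)
  have e1 := integral_mul_primitive_add iw iw g g
  have e2 := integral_mul_primitive_add iq iq h h
  rw [← H.fst_eq t ht] at e1
  rw [← H.snd_eq t ht] at e2
  have c1 : ∫ x in (0 : ℝ)..t, (w x * (g + ∫ y in (0 : ℝ)..x, w y) +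
      (g + ∫ y in (0 : ℝ)..x, w y) * w x) = ∫ x in (0 : ℝ)..t, 2 * (w x * v x) :=
    intervalIntegral.integral_congr fun x hx => by
      simp only [← H.fst_eq x (hsub hx)]
      ring
  have c2 : ∫ x in (0 : ℝ)..t, ((f x - μ * v x) * (h + ∫ y in (0 : ℝ)..x, (f y - μ * v y)) +
      (h + ∫ y in (0 : ℝ)..x, (f y - μ * v y)) * (f x - μ * v x)) =
      ∫ x in (0 : ℝ)..t, (2 * (f x * w x) - μ * (2 * (w x * v x))) :=
    intervalIntegral.integral_congr fun x hx => by
      simp only [← H.snd_eq x (hsub hx)]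
      ring
  have iwv : IntervalIntegrable (fun x => 2 * (w x * v x)) volume 0 t :=
    ((hw.mul hv).intervalIntegrable).const_mul 2
  have ifw : IntervalIntegrable (fun x => f x * w x) volume 0 t := jf.mul_continuousOn hw
  rw [c1] at e1
  rw [c2, intervalIntegral.integral_sub (ifw.const_mul 2) (iwv.const_mul μ),
    intervalIntegral.integral_const_mul, intervalIntegral.integral_const_mul, e1] at e2
  linarith

/-- Evaluate the energy identity at a time `r` where the energy attains its maximum `E`. Young's
inequality `f w ≤ T f² + w² / (4T)` together with `w² ≤ E` bounds the forcing term `2 ∫ f w` by `2T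
∫ f² + E / 2`, and half of `E` is absorbed on the left. No Gronwall argument is needed and the
constants do not depend on `μ`. -/
theorem energy_le (H : IsOscillation T μ f g h v w) (hT : 0 < T) (hμ : 0 ≤ μ)
    (hf : IntervalIntegrable f volume 0 T) (hf2 : IntervalIntegrable (fun t => f t ^ 2) volume 0 T)
    {t : ℝ} (ht : t ∈ Icc 0 T) :
    w t ^ 2 + μ * v t ^ 2 ≤
      2 * (h ^ 2 + μ * g ^ 2) + 4 * T * ∫ τ in (0 : ℝ)..T, f τ ^ 2 := by
  obtain ⟨r, hr, hmax⟩ := isCompact_Icc.exists_isMaxOn (nonempty_Icc.mpr hT.le)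
    ((H.continuousOn_snd.pow 2).add ((H.continuousOn_fst.pow 2).const_mul μ) :
      ContinuousOn (fun t => w t ^ 2 + μ * v t ^ 2) (Icc 0 T))
  refine (hmax ht).trans ?_
  change w r ^ 2 + μ * v r ^ 2 ≤ _
  set E := w r ^ 2 + μ * v r ^ 2 with hE
  have e := H.energy_eq hf hr
  rw [← hE] at e
  have hsub : uIcc 0 r ⊆ Icc 0 T := by
    rw [uIcc_of_le hr.1]
    exact Icc_subset_Icc_right hr.2
  have hsub' : uIcc 0 r ⊆ uIcc 0 T := by
    rwa [uIcc_of_le hT.le]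
  have hw := H.continuousOn_snd.mono hsub
  have jf2 := hf2.mono_set hsub'
  have hE0 : 0 ≤ E := by positivity
  have b1 : ∫ τ in (0 : ℝ)..r, f τ * w τ ≤ ∫ τ in (0 : ℝ)..r, (T * f τ ^ 2 + E / (4 * T)) := by
    refine intervalIntegral.integral_mono_on hr.1 ((hf.mono_set hsub').mul_continuousOn hw)
      ((jf2.const_mul T).add intervalIntegrable_const) fun x hx => ?_
    have hx' : x ∈ Icc 0 T := ⟨hx.1, hx.2.trans hr.2⟩
    have h1 : w x ^ 2 + μ * v x ^ 2 ≤ E := hmax hx'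
    have h2 : w x ^ 2 ≤ E := by nlinarith [mul_nonneg hμ (sq_nonneg (v x))]
    have h3 : w x ^ 2 / (4 * T) ≤ E / (4 * T) := by gcongr
    have h4 : T * f x ^ 2 + w x ^ 2 / (4 * T) - f x * w x = (2 * T * f x - w x) ^ 2 / (4 * T) := by
      field_simp
      ring
    have h5 : 0 ≤ (2 * T * f x - w x) ^ 2 / (4 * T) := by positivity
    linarith
  have b2 : ∫ τ in (0 : ℝ)..r, f τ ^ 2 ≤ ∫ τ in (0 : ℝ)..T, f τ ^ 2 :=
    intervalIntegral.integral_mono_interval le_rfl hr.1 hr.2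
      (Eventually.of_forall fun x => sq_nonneg _) hf2
  rw [intervalIntegral.integral_add (jf2.const_mul T) intervalIntegrable_const,
    intervalIntegral.integral_const_mul, intervalIntegral.integral_const, smul_eq_mul] at b1
  have b3 : (r - 0) * (E / (4 * T)) ≤ T * (E / (4 * T)) := by
    have := hr.2
    gcongr
    linarith
  have b4 : T * (E / (4 * T)) = E / 4 := by
    field_simp
  have b5 := mul_le_mul_of_nonneg_left b2 hT.le
  linarith

/-- By linearity the difference has zero data and zero forcing, so its energy vanishes; since `μ >
0`, both components are zero. -/
theorem unique (H : IsOscillation T μ f g h v w) {v' w' : ℝ → ℝ}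
    (H' : IsOscillation T μ f g h v' w') (hμ : 0 < μ)
    (hf : IntervalIntegrable f volume 0 T) {t : ℝ} (ht : t ∈ Icc 0 T) :
    v t = v' t ∧ w t = w' t := by
  have hI : ∀ {u : ℝ → ℝ} {t}, ContinuousOn u (Icc 0 T) → t ∈ Icc 0 T →
      IntervalIntegrable u volume 0 t := fun hu ht => by
    refine (hu.mono ?_).intervalIntegrable
    rw [uIcc_of_le ht.1]
    exact Icc_subset_Icc_right ht.2
  have D : IsOscillation T μ (fun _ => 0) 0 0 (fun t => v t - v' t) (fun t => w t - w' t) := by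
    refine ⟨H.1.sub H'.1, H.2.sub H'.2, fun t ht => ?_, fun t ht => ?_⟩
    · rw [H.fst_eq t ht, H'.fst_eq t ht, intervalIntegral.integral_sub (hI H.2 ht) (hI H'.2 ht)]
      ring
    · have jf : IntervalIntegrable f volume 0 t := hf.mono_set (by
        rw [uIcc_of_le ht.1, uIcc_of_le (ht.1.trans ht.2)]
        exact Icc_subset_Icc_right ht.2)
      rw [H.snd_eq t ht, H'.snd_eq t ht, add_sub_add_left_eq_sub, zero_add,
        ← intervalIntegral.integral_sub (jf.sub ((hI H.1 ht).const_mul μ))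
          (jf.sub ((hI H'.1 ht).const_mul μ))]
      refine intervalIntegral.integral_congr fun x _ => ?_
      ring
  have e := D.energy_eq intervalIntegrable_const ht
  simp only [zero_mul, intervalIntegral.integral_zero] at e
  have h1 := sq_nonneg (w t - w' t)
  have h2 := mul_nonneg hμ.le (sq_nonneg (v t - v' t))
  have h3 : (w t - w' t) ^ 2 = 0 := by linarith
  have h4 : μ * (v t - v' t) ^ 2 = 0 := by linarith
  constructor
  · have := (mul_eq_zero.mp h4).resolve_left hμ.ne'
    exact sub_eq_zero.mp (pow_eq_zero_iff (two_ne_zero) |>.mp this)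
  · exact sub_eq_zero.mp (pow_eq_zero_iff (two_ne_zero) |>.mp h3)

/-- The forcing enters only through its continuous primitive `F = h + ∫ f`. Writing `w = F + p`, the
problem becomes the system `v' = F + p`, `p' = -μ v`, `v(0) = g`, `p(0) = 0`, whose right-hand side
is continuous, so the solution formula can be verified by classical differentiation. -/
theorem exists_of_integrable (T : ℝ) (hμ : 0 < μ) (hf : Integrable f) (g h : ℝ) :
    ∃ v w, IsOscillation T μ f g h v w := by
  set ν := √μ with hν
  have hν2 : ν * ν = μ := Real.mul_self_sqrt hμ.le
  set F : ℝ → ℝ := fun t => h + ∫ τ in (0 : ℝ)..t, f τ with hF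
  have hFc : Continuous F := continuous_const.add
    (intervalIntegral.continuous_primitive (fun a b => hf.intervalIntegrable) 0)
  set C : ℝ → ℝ := fun t => ∫ τ in (0 : ℝ)..t, Real.cos (ν * τ) * F τ with hC
  set S : ℝ → ℝ := fun t => ∫ τ in (0 : ℝ)..t, Real.sin (ν * τ) * F τ with hS
  have dC : ∀ t, HasDerivAt C (Real.cos (ν * t) * F t) t := fun t =>
    (Continuous.integral_hasStrictDerivAt (by fun_prop) 0 t).hasDerivAt
  have dS : ∀ t, HasDerivAt S (Real.sin (ν * t) * F t) t := fun t =>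
    (Continuous.integral_hasStrictDerivAt (by fun_prop) 0 t).hasDerivAt
  have dl : ∀ t, HasDerivAt (fun t => ν * t) ν t := fun t => by
    simpa using (hasDerivAt_id t).const_mul ν
  have dc : ∀ t, HasDerivAt (fun t => Real.cos (ν * t)) (-Real.sin (ν * t) * ν) t := fun t =>
    (dl t).cos
  have ds : ∀ t, HasDerivAt (fun t => Real.sin (ν * t)) (Real.cos (ν * t) * ν) t := fun t =>
    (dl t).sin
  -- Duhamel's formula `v(t) = g cos νt + ∫₀ᵗ cos(ν(t - τ)) F(τ) dτ`, with the cosine expanded so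
  -- that `t` leaves the integrand.
  set v : ℝ → ℝ := fun t => Real.cos (ν * t) * (g + C t) + Real.sin (ν * t) * S t with hv
  set p : ℝ → ℝ := fun t => ν * (Real.cos (ν * t) * S t - Real.sin (ν * t) * (g + C t)) with hp
  have dv : ∀ t, HasDerivAt v (F t + p t) t := fun t => by
    have := ((dc t).mul ((dC t).const_add g)).add ((ds t).mul (dS t))
    convert! this using 1
    simp only [hp]
    linear_combination (-F t) * Real.sin_sq_add_cos_sq (ν * t)
  have dp : ∀ t, HasDerivAt p (-(μ * v t)) t := fun t => by
    have := (((dc t).mul (dS t)).sub ((ds t).mul ((dC t).const_add g))).const_mul ν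
    convert! this using 1
    simp only [hv]
    rw [← hν2]
    ring
  have hvc : Continuous v := continuous_iff_continuousAt.mpr fun t => (dv t).continuousAt
  have hpc : Continuous p := continuous_iff_continuousAt.mpr fun t => (dp t).continuousAt
  refine ⟨v, fun t => F t + p t, hvc.continuousOn, (hFc.add hpc).continuousOn,
    fun t _ => ?_, fun t _ => ?_⟩
  · rw [intervalIntegral.integral_eq_sub_of_hasDerivAt (fun x _ => dv x)
      ((hFc.add hpc).intervalIntegrable _ _)]
    simp [hv, hC, hS]
  · rw [intervalIntegral.integral_sub hf.intervalIntegrable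
      ((hvc.const_mul μ).intervalIntegrable _ _)]
    have e := intervalIntegral.integral_eq_sub_of_hasDerivAt (a := 0) (b := t) (fun x _ => dp x)
      ((hvc.const_mul μ).neg.intervalIntegrable _ _)
    rw [intervalIntegral.integral_neg] at e
    have p0 : p 0 = 0 := by simp [hp, hS]
    rw [p0] at e
    simp only [hF]
    linarith

theorem congr_ae (H : IsOscillation T μ f g h v w) {f' : ℝ → ℝ}
    (hf : f =ᵐ[timeMeasure T] f') : IsOscillation T μ f' g h v w := by
  refine ⟨H.1, H.2, H.3, fun t ht => ?_⟩
  rw [H.snd_eq t ht]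
  congr 1
  rw [intervalIntegral.integral_of_le ht.1, intervalIntegral.integral_of_le ht.1,
    integral_Ioc_eq_integral_Ioo, integral_Ioc_eq_integral_Ioo]
  refine integral_congr_ae ?_
  have := ae_restrict_of_ae_restrict_of_subset (Ioo_subset_Ioo_right ht.2) hf
  filter_upwards [this] with x hx
  rw [hx]

theorem congr_on (H : IsOscillation T μ f g h v w) {v' w' : ℝ → ℝ}
    (hv : EqOn v v' (Icc 0 T)) (hw : EqOn w w' (Icc 0 T)) : IsOscillation T μ f g h v' w' := by
  have hsub : ∀ {t}, t ∈ Icc 0 T → uIcc 0 t ⊆ Icc 0 T := fun ht => by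
    rw [uIcc_of_le ht.1]
    exact Icc_subset_Icc_right ht.2
  refine ⟨H.1.congr hv.symm, H.2.congr hw.symm, fun t ht => ?_, fun t ht => ?_⟩
  · rw [← hv ht, H.fst_eq t ht]
    congr 1
    exact intervalIntegral.integral_congr fun x hx => hw (hsub ht hx)
  · rw [← hw ht, H.snd_eq t ht]
    congr 1
    exact intervalIntegral.integral_congr fun x hx => by simp only [hv (hsub ht hx)]

end IsOscillation

theorem intervalIntegrable_of_timeMeasure {E : Type*} [NormedAddCommGroup E] {T : ℝ} (hT : 0 ≤ T)
    {f : ℝ → E} (hf : Integrable f (timeMeasure T)) : IntervalIntegrable f volume 0 T :=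
  (intervalIntegrable_iff_integrableOn_Ioo_of_le hT).mpr hf

theorem integral_timeMeasure {E : Type*} [NormedAddCommGroup E] [NormedSpace ℝ E] {T : ℝ}
    (hT : 0 ≤ T) (f : ℝ → E) : ∫ t, f t ∂timeMeasure T = ∫ t in (0 : ℝ)..T, f t := by
  rw [intervalIntegral.integral_of_le hT, integral_Ioc_eq_integral_Ioo, timeMeasure]

/-- The forcing is extended by zero outside `(0, T)` to be integrable on the line; an oscillation
only sees the almost everywhere class of `f` on `(0, T)`. -/
theorem IsOscillation.exists {T μ : ℝ} (hμ : 0 < μ) {f : ℝ → ℝ}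
    (hf : Integrable f (timeMeasure T)) (g h : ℝ) : ∃ v w, IsOscillation T μ f g h v w := by
  obtain ⟨v, w, H⟩ := IsOscillation.exists_of_integrable T hμ
    ((integrable_indicator_iff measurableSet_Ioo).mpr hf) g h
  exact ⟨v, w, H.congr_ae (indicator_ae_eq_restrict measurableSet_Ioo)⟩

/-! ### Weak time derivatives of scalar functions -/

instance (T : ℝ) : IsFiniteMeasure (timeMeasure T) := by
  unfold timeMeasure
  infer_instance

/-- A continuous function with vanishing weak derivative is constant. -/
theorem eq_of_forall_integral_deriv_mul_eq_zero {T : ℝ} {d : ℝ → ℝ}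
    (hd : ContinuousOn d (Icc 0 T))
    (h : ∀ φ : ℝ → ℝ, ContDiff ℝ ∞ φ → HasCompactSupport φ → tsupport φ ⊆ Ioo 0 T →
      ∫ t, deriv φ t * d t ∂timeMeasure T = 0) {t : ℝ} (ht : t ∈ Icc 0 T) : d t = d 0 := by
  rcases eq_or_lt_of_le (ht.1.trans ht.2) with hT | hT
  · have : t = 0 := le_antisymm (ht.2.trans hT.ge) ht.1
    rw [this]
  have hdi : Integrable d (timeMeasure T) :=
    (hd.integrableOn_Icc (μ := volume)).mono_set Ioo_subset_Icc_self
  have hφi : ∀ φ : ℝ → ℝ, Continuous φ → HasCompactSupport φ →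
      Integrable (fun t => φ t * d t) (timeMeasure T) := fun φ hφ hc => by
    obtain ⟨K, hK⟩ := hφ.bounded_above_of_compact_support hc
    exact hdi.bdd_mul hφ.aestronglyMeasurable (Eventually.of_forall hK)
  have hsupp : ∀ φ : ℝ → ℝ, tsupport φ ⊆ Ioo 0 T → ∫ t, φ t ∂timeMeasure T = ∫ t, φ t :=
    fun φ hφ => setIntegral_eq_integral_of_forall_compl_eq_zero fun x hx => by
      by_contra hne
      exact hx (hφ (subset_tsupport _ hne))
  let η₀ : ContDiffBump (T / 2) := ⟨T / 8, T / 4, by positivity, by linarith⟩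
  have hη₀s : tsupport η₀ ⊆ Ioo 0 T := by
    rw [η₀.tsupport_eq]
    intro x hx
    rw [Metric.mem_closedBall, Real.dist_eq, abs_le] at hx
    have : η₀.rOut = T / 4 := rfl
    constructor <;> linarith [hx.1, hx.2]
  set η : ℝ → ℝ := fun x => η₀ x / ∫ y, η₀ y with hη
  have hηI : ∫ x, η x = 1 := by
    rw [integral_div, div_self η₀.integral_pos.ne']
  have hηd : ContDiff ℝ ∞ η := η₀.contDiff.div_const _
  have hηc : HasCompactSupport η := by
    simp only [hη, div_eq_mul_inv]
    exact η₀.hasCompactSupport.mul_right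
  have hηs : tsupport η ⊆ Ioo 0 T := by
    refine (closure_mono ?_).trans hη₀s
    intro x hx hx0
    exact hx (by simp [hη, hx0])
  -- The candidate for the constant value of `d`: its average against a test function `η` of
  -- integral one.
  set c := ∫ t, η t * d t ∂timeMeasure T with hc
  have key : ∀ χ : ℝ → ℝ, ContDiff ℝ ∞ χ → HasCompactSupport χ → tsupport χ ⊆ Ioo 0 T →
      ∫ t, χ t • (d t - c) ∂timeMeasure T = 0 := by
    intro χ hχd hχc hχs
    set m := ∫ x, χ x with hm
    -- Subtracting the multiple of `η` with the same integral leaves a function of mean zero. Its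
    -- primitive `ψ` is again compactly supported in `(0, T)`, so the hypothesis applies to `ψ`,
    -- whose derivative is `κ`.
    set κ : ℝ → ℝ := fun x => χ x - m * η x with hκ
    have hκd : ContDiff ℝ ∞ κ := hχd.sub (contDiff_const.mul hηd)
    have hK : IsCompact (tsupport χ ∪ tsupport η) := hχc.isCompact.union hηc.isCompact
    -- A primitive need not vanish in gaps of the support of `κ`, only outside its convex hull;
    -- hence the enclosing interval `[a, b]`.
    obtain ⟨a, b, ha, hb, hab⟩ : ∃ a b, 0 < a ∧ b < T ∧ tsupport χ ∪ tsupport η ⊆ Icc a b := by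
      rcases (tsupport χ ∪ tsupport η).eq_empty_or_nonempty with he | hne
      · exact ⟨T / 2, T / 2, by linarith, by linarith, by simp [he]⟩
      · obtain ⟨a, ha⟩ := hK.exists_isLeast hne
        obtain ⟨b, hb⟩ := hK.exists_isGreatest hne
        exact ⟨a, b, (union_subset hχs hηs ha.1).1, (union_subset hχs hηs hb.1).2,
          fun x hx => ⟨ha.2 hx, hb.2 hx⟩⟩
    have hκz : ∀ x, x ∉ Icc a b → κ x = 0 := fun x hx => by
      have h1 : χ x = 0 := by
        by_contra hne
        exact hx (hab (Or.inl (subset_tsupport _ hne)))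
      have h2 : η x = 0 := by
        by_contra hne
        exact hx (hab (Or.inr (subset_tsupport _ hne)))
      simp [hκ, h1, h2]
    have hχI : Integrable χ := hχd.continuous.integrable_of_hasCompactSupport hχc
    have hηint : Integrable η := hηd.continuous.integrable_of_hasCompactSupport hηc
    have hκI : Integrable κ := hχI.sub (hηint.const_mul m)
    have hκ0 : ∫ x, κ x = 0 := by
      rw [integral_sub hχI (hηint.const_mul m), integral_const_mul, hηI, mul_one, ← hm, sub_self]
    set ψ : ℝ → ℝ := fun x => ∫ y in (0 : ℝ)..x, κ y with hψ
    have dψ : ∀ x, HasDerivAt ψ (κ x) x := fun x =>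
      (hκd.continuous.integral_hasStrictDerivAt 0 x).hasDerivAt
    have hdψ : deriv ψ = κ := funext fun x => (dψ x).deriv
    have hψd : ContDiff ℝ ∞ ψ := by
      rw [contDiff_infty_iff_deriv]
      exact ⟨fun x => (dψ x).differentiableAt, hdψ ▸ hκd⟩
    have hψz : ∀ x, x ∉ Icc a b → ψ x = 0 := fun x hx => by
      rcases lt_or_ge x a with hxa | hxa
      · refine intervalIntegral.integral_zero_ae (Eventually.of_forall fun y hy => hκz y ?_)
        intro hy'
        have := hy.2
        rw [le_max_iff] at this
        rcases this with h0 | h0 <;> linarith [hy'.1]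
      · have hxb : b < x := by
          by_contra hle
          exact hx ⟨hxa, not_lt.mp hle⟩
        have : ∫ y in (0 : ℝ)..x, κ y = ∫ y, κ y := by
          refine intervalIntegral.integral_eq_integral_of_support_subset fun y hy => ?_
          have : y ∈ Icc a b := by
            by_contra hne
            exact hy (hκz y hne)
          exact ⟨ha.trans_le this.1, this.2.trans hxb.le⟩
        simp only [hψ, this, hκ0]
    have hψs : tsupport ψ ⊆ Icc a b := closure_minimal (fun x hx => by
      by_contra hne
      exact hx (hψz x hne)) isClosed_Icc
    have h0 := h ψ hψd (isCompact_Icc.of_isClosed_subset (isClosed_tsupport _) hψs)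
      (hψs.trans (Icc_subset_Ioo ha hb))
    rw [hdψ] at h0
    have e1 : ∫ t, κ t * d t ∂timeMeasure T = (∫ t, χ t * d t ∂timeMeasure T) - m * c := by
      rw [hc, ← integral_const_mul, ← integral_sub (hφi χ hχd.continuous hχc)
        ((hφi η hηd.continuous hηc).const_mul m)]
      refine integral_congr_ae (Eventually.of_forall fun t => ?_)
      simp only [hκ]
      ring
    have e2 : ∫ t, χ t • (d t - c) ∂timeMeasure T =
        (∫ t, χ t * d t ∂timeMeasure T) - (∫ t, χ t ∂timeMeasure T) * c := by
      rw [← integral_mul_const, ← integral_sub (hφi χ hχd.continuous hχc)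
        ((hχI.mono_measure Measure.restrict_le_self).mul_const c)]
      refine integral_congr_ae (Eventually.of_forall fun t => ?_)
      simp only [smul_eq_mul]
      ring
    rw [e2, hsupp χ hχs, ← hm, ← e1, h0]
  have hloc : LocallyIntegrableOn (fun t => d t - c) (Ioo 0 T) volume :=
    IntegrableOn.locallyIntegrableOn (hdi.sub (integrable_const c))
  have hae := isOpen_Ioo.ae_eq_zero_of_integral_contDiff_smul_eq_zero hloc
    (fun χ h1 h2 h3 => by
      rw [← key χ h1 h2 h3]
      refine (setIntegral_eq_integral_of_forall_compl_eq_zero fun x hx => ?_).symm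
      have : χ x = 0 := by
        by_contra hne
        exact hx (h3 (subset_tsupport _ hne))
      rw [this, zero_smul])
  have hae' : d =ᵐ[volume.restrict (Ioo 0 T)] fun _ => c := by
    rw [EventuallyEq, ae_restrict_iff' measurableSet_Ioo]
    filter_upwards [hae] with x hx hx'
    linarith [hx hx']
  -- Continuity upgrades almost everywhere equality to equality on `(0, T)`, then on its closure,
  -- which includes the initial time.
  have hEq : EqOn d (fun _ => c) (Icc 0 T) := by
    have h1 : EqOn d (fun _ => c) (Ioo 0 T) :=
      Measure.eqOn_open_of_ae_eq hae' isOpen_Ioo (hd.mono Ioo_subset_Icc_self) continuousOn_const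
    refine h1.of_subset_closure hd continuousOn_const Ioo_subset_Icc_self ?_
    rw [closure_Ioo hT.ne]
  rw [hEq ht, hEq ⟨le_rfl, hT.le⟩]

/-- Integration by parts for an absolutely continuous factor: `φ` is the primitive of `deriv φ`, and
the boundary terms vanish because its support lies in the open interval. -/
theorem integral_deriv_mul_primitive {T : ℝ} (hT : 0 ≤ T) {q : ℝ → ℝ}
    (hq : Integrable q (timeMeasure T)) (a : ℝ) {φ : ℝ → ℝ} (hφ : ContDiff ℝ ∞ φ)
    (hs : tsupport φ ⊆ Ioo 0 T) :
    ∫ t, deriv φ t * (a + ∫ τ in (0 : ℝ)..t, q τ) ∂timeMeasure T =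
      -∫ t, φ t * q t ∂timeMeasure T := by
  have hq' := intervalIntegrable_of_timeMeasure hT hq
  have hz : ∀ x, x ∉ Ioo 0 T → φ x = 0 := fun x hx => by
    by_contra hne
    exact hx (hs (subset_tsupport _ hne))
  have hdc : Continuous (deriv φ) := hφ.continuous_deriv (by simp)
  have hφt : ∀ t, φ 0 + ∫ y in (0 : ℝ)..t, deriv φ y = φ t := fun t => by
    rw [intervalIntegral.integral_deriv_eq_sub
      (fun x _ => (hφ.differentiable (by simp)).differentiableAt) (hdc.intervalIntegrable _ _)]
    ring
  have e := integral_mul_primitive_add (hdc.intervalIntegrable 0 T) hq' (φ 0) a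
  simp only [hφt] at e
  rw [hz 0 (by simp), hz T (by simp), intervalIntegral.integral_add] at e
  · rw [integral_timeMeasure hT, integral_timeMeasure hT]
    linarith
  · refine (hdc.continuousOn.mul (continuousOn_const.add ?_)).intervalIntegrable
    exact intervalIntegral.continuousOn_primitive_interval' hq' left_mem_uIcc
  · exact hq'.continuousOn_mul hφ.continuous.continuousOn

/-- Both `v` and the primitive of `z` have weak derivative `z`; their difference is continuous with
zero weak derivative, hence constant. This turns weak solutions into integral equations. -/
theorem HasWeakTimeDeriv.eq_add_integral {T : ℝ} (hT : 0 ≤ T) {y z v : ℝ → ℝ}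
    (h : HasWeakTimeDeriv T y z) (hz : Integrable z (timeMeasure T))
    (hv : ContinuousOn v (Icc 0 T)) (hyv : y =ᵐ[timeMeasure T] v) {t : ℝ} (ht : t ∈ Icc 0 T) :
    v t = v 0 + ∫ τ in (0 : ℝ)..t, z τ := by
  have hz' := intervalIntegrable_of_timeMeasure hT hz
  have hp : ContinuousOn (fun t => ∫ τ in (0 : ℝ)..t, z τ) (Icc 0 T) := by
    have := intervalIntegral.continuousOn_primitive_interval' hz' left_mem_uIcc
    rwa [uIcc_of_le hT] at this
  have hdi : ∀ {d : ℝ → ℝ}, ContinuousOn d (Icc 0 T) → ∀ φ : ℝ → ℝ, Continuous φ →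
      Integrable (fun t => φ t * d t) (timeMeasure T) := fun hd φ hφ =>
    ((hφ.continuousOn.mul hd).integrableOn_Icc (μ := volume)).mono_set Ioo_subset_Icc_self
  have := eq_of_forall_integral_deriv_mul_eq_zero (hv.sub hp) (fun φ hφ hc hs => by
    have h1 := h φ hφ hc hs
    have h2 := integral_deriv_mul_primitive hT hz 0 hφ hs
    simp only [zero_add] at h2
    have hdc : Continuous (deriv φ) := hφ.continuous_deriv (by simp)
    simp only [Pi.sub_apply, mul_sub]
    rw [integral_sub (hdi hv _ hdc) (hdi hp _ hdc), h2]
    have h3 : ∫ t, deriv φ t * v t ∂timeMeasure T = ∫ t, deriv φ t • y t ∂timeMeasure T := by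
      refine integral_congr_ae ?_
      filter_upwards [hyv] with t ht
      rw [ht, smul_eq_mul]
    rw [h3, h1]
    simp) ht
  simp only [Pi.sub_apply, intervalIntegral.integral_same, sub_zero] at this
  linarith

/-! ### Sequence spaces -/

theorem lp_norm_sq_eq_tsum (a : lp (fun _ : ℕ => ℝ) 2) : ‖a‖ ^ 2 = ∑' k, a k ^ 2 := by
  have h := lp.hasSum_inner (𝕜 := ℝ) a a
  rw [real_inner_self_eq_norm_sq] at h
  rw [← h.tsum_eq]
  exact tsum_congr fun k => by rw [real_inner_self_eq_norm_sq, Real.norm_eq_abs, sq_abs]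

theorem memlp_two_of_summable {a : ℕ → ℝ} (h : Summable fun k => a k ^ 2) : Memℓp a 2 :=
  memℓp_gen (h.congr fun k => by simp)

/-- A map into `ℓ²` with continuous coordinates and a square summable majorant is continuous. -/
theorem continuousOn_lp_of_dominated {S : Set ℝ} {A : ℝ → lp (fun _ : ℕ => ℝ) 2} {M : ℕ → ℝ}
    (hM : Summable M) (hA : ∀ k, ContinuousOn (fun t => A t k) S)
    (hb : ∀ t ∈ S, ∀ k, A t k ^ 2 ≤ M k) : ContinuousOn A S := by
  intro t₀ ht₀
  have h1 : Tendsto (fun t => ∑' k, (A t k - A t₀ k) ^ 2) (𝓝[S] t₀)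
      (𝓝 (∑' k, (A t₀ k - A t₀ k) ^ 2)) := by
    -- The factor comes from `(a - b)² ≤ 2a² + 2b²` with both squares at most `M k`.
    refine tendsto_tsum_of_dominated_convergence (hM.mul_left 4)
      (fun k => ((hA k t₀ ht₀).tendsto.sub_const _).pow 2) ?_
    filter_upwards [self_mem_nhdsWithin] with t ht k
    rw [Real.norm_eq_abs, abs_of_nonneg (sq_nonneg _)]
    nlinarith [hb t ht k, hb t₀ ht₀ k, sq_nonneg (A t k + A t₀ k)]
  have h2 : ∀ t, ∑' k, (A t k - A t₀ k) ^ 2 = ‖A t - A t₀‖ ^ 2 := fun t =>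
    (lp_norm_sq_eq_tsum (A t - A t₀)).symm
  simp only [h2, sub_self] at h1
  rw [ContinuousWithinAt, tendsto_iff_norm_sub_tendsto_zero]
  have h3 := (Real.continuous_sqrt.tendsto _).comp h1
  simpa [Function.comp_def, Real.sqrt_sq (norm_nonneg _)] using h3

theorem exists_continuousOn_lp {S : Set ℝ} {a : ℕ → ℝ → ℝ} {M : ℕ → ℝ} {m : ℝ}
    (hM : HasSum M m) (ha : ∀ k, ContinuousOn (a k) S) (hb : ∀ t ∈ S, ∀ k, a k t ^ 2 ≤ M k) :
    ∃ A : ℝ → lp (fun _ : ℕ => ℝ) 2, ContinuousOn A S ∧ (∀ t ∈ S, ∀ k, A t k = a k t) ∧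
      ∀ t ∈ S, ‖A t‖ ^ 2 ≤ m := by
  classical
  have hs : ∀ t ∈ S, Summable fun k => a k t ^ 2 := fun t ht =>
    Summable.of_nonneg_of_le (fun k => sq_nonneg _) (hb t ht) hM.summable
  let A : ℝ → lp (fun _ : ℕ => ℝ) 2 := fun t =>
    if ht : t ∈ S then ⟨fun k => a k t, memlp_two_of_summable (hs t ht)⟩ else 0
  have hA : ∀ t ∈ S, ∀ k, A t k = a k t := fun t ht k => by
    simp only [A, dif_pos ht]
  refine ⟨A, continuousOn_lp_of_dominated hM.summable (fun k => (ha k).congr fun t ht => hA t ht k)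
    (fun t ht k => ?_), hA, fun t ht => ?_⟩
  · rw [hA t ht]
    exact hb t ht k
  · rw [lp_norm_sq_eq_tsum, ← hM.tsum_eq]
    simp only [hA t ht]
    exact (hs t ht).tsum_le_tsum (hb t ht) hM.summable

/-! ### Coordinates in the eigenbasis -/

namespace Eigenbasis

variable {P : EllipticOperator n} (B : Eigenbasis P)

theorem eq_of_coeff_eq {v w : L2 P} (h : ∀ k, B.coeff v k = B.coeff w k) : v = w := by
  apply B.basis.repr.injective
  ext k
  rw [B.basis.repr_apply_apply, B.basis.repr_apply_apply]
  exact h k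

theorem coeff_repr_symm (a : lp (fun _ : ℕ => ℝ) 2) (k : ℕ) :
    B.coeff (B.basis.repr.symm a) k = a k := by
  rw [coeff, ← B.basis.repr_apply_apply, LinearIsometryEquiv.apply_symm_apply]

/-- The coefficient functional `w ↦ w_k`. -/
def coeffL (k : ℕ) : L2 P →L[ℝ] ℝ := innerSL ℝ (B.basis k)

theorem coeffL_apply (k : ℕ) (w : L2 P) : B.coeffL k w = B.coeff w k := rfl

/-! ### `ℍ^s(Ω)` as a copy of `ℓ²`, and eigenfunctions as test vectors -/

namespace Hs

variable (s : ℝ≥0)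

theorem rpow_half_sq (k : ℕ) :
    (B.eigval k ^ ((s : ℝ) / 2)) ^ 2 = B.eigval k ^ (s : ℝ) := by
  rw [← Real.rpow_natCast, ← Real.rpow_mul (B.eigval_pos k).le]
  norm_num

/-- The preimage of `a` has coefficients `a_k / λ_k^{s/2}`. They are square summable because the
eigenvalues are bounded below by a positive constant. This permits curves in `ℍ^s(Ω)` to be
constructed in `ℓ²`. -/
theorem toSeq_surjective : Function.Surjective (toSeq B s) := by
  intro a
  obtain ⟨m, hm, hle⟩ := B.exists_le_eigval
  have hpos : ∀ k, 0 < B.eigval k ^ ((s : ℝ) / 2) := fun k =>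
    Real.rpow_pos_of_pos (B.eigval_pos k) _
  have hmpos : 0 < m ^ ((s : ℝ) / 2) := Real.rpow_pos_of_pos hm _
  have ha : Summable fun k => a k ^ 2 := by
    have := (lp.hasSum_inner (𝕜 := ℝ) a a).summable
    refine this.congr fun k => ?_
    rw [real_inner_self_eq_norm_sq, Real.norm_eq_abs, sq_abs]
  let b : lp (fun _ : ℕ => ℝ) 2 := ⟨fun k => a k / B.eigval k ^ ((s : ℝ) / 2), by
    refine memlp_two_of_summable (Summable.of_nonneg_of_le (fun k => sq_nonneg _) (fun k => ?_)
      (ha.mul_right ((m ^ ((s : ℝ) / 2)) ^ 2)⁻¹))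
    rw [div_pow, div_eq_mul_inv]
    have := Real.rpow_le_rpow hm.le (hle k) (z := (s : ℝ) / 2) (by positivity)
    gcongr⟩
  have hb : ∀ k, b k = a k / B.eigval k ^ ((s : ℝ) / 2) := fun k => rfl
  refine ⟨⟨B.basis.repr.symm b, ?_⟩, ?_⟩
  · change Summable fun k => B.eigval k ^ (s : ℝ) * B.coeff (B.basis.repr.symm b) k ^ 2
    refine ha.congr fun k => ?_
    rw [coeff_repr_symm, hb, div_pow, rpow_half_sq]
    have := Real.rpow_pos_of_pos (B.eigval_pos k) s
    field_simp
  · ext k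
    change B.eigval k ^ ((s : ℝ) / 2) * B.coeff (B.basis.repr.symm b) k = a k
    rw [coeff_repr_symm, hb]
    have := hpos k
    field_simp

/-- `toSeq` as an isometric isomorphism of `ℍ^s(Ω)` onto `ℓ²`. -/
def toSeqEquiv : B.Hs s ≃ₗᵢ[ℝ] lp (fun _ : ℕ => ℝ) 2 :=
  LinearIsometryEquiv.ofSurjective ⟨toSeq B s, norm_toSeq B s⟩ (toSeq_surjective B s)

theorem toSeqEquiv_apply (w : B.Hs s) : toSeqEquiv B s w = toSeq B s w := rfl

theorem coeff_toSeqEquiv_symm (a : lp (fun _ : ℕ => ℝ) 2) (k : ℕ) :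
    B.eigval k ^ ((s : ℝ) / 2) * B.coeff (toL2 B s ((toSeqEquiv B s).symm a)) k = a k := by
  have := toSeq_apply B s ((toSeqEquiv B s).symm a) k
  rw [← toSeqEquiv_apply, LinearIsometryEquiv.apply_symm_apply] at this
  exact this.symm

theorem coeff_basis (j k : ℕ) : B.coeff (B.basis k) j = if j = k then 1 else 0 :=
  orthonormal_iff_ite.mp B.basis.orthonormal j k

/-- The eigenfunction `φ_k` as an element of `ℍ^s(Ω)`. -/
def eigenfun (k : ℕ) : B.Hs s :=
  ⟨B.basis k, by
    change Summable fun j => B.eigval j ^ (s : ℝ) * B.coeff (B.basis k) j ^ 2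
    refine summable_of_ne_finset_zero (s := {k}) fun j hj => ?_
    rw [coeff_basis, if_neg (by simpa using hj)]
    ring⟩

theorem toL2_eigenfun (k : ℕ) : toL2 B s (eigenfun B s k) = B.basis k := rfl

theorem toSeq_eigenfun (k : ℕ) :
    toSeq B s (eigenfun B s k) = lp.single 2 k (B.eigval k ^ ((s : ℝ) / 2)) := by
  ext j
  rw [toSeq_apply]
  change B.eigval j ^ ((s : ℝ) / 2) * B.coeff (B.basis k) j = _
  rw [coeff_basis, lp.coeFn_single]
  by_cases h : j = k
  · subst h
    simp
  · simp [h]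

/-- The expansion converges in the norm of `ℍ^s(Ω)`, being the image of the coordinate expansion in
`ℓ²` under the isometry. Convergence in `L²(Ω)` would not suffice for applying elements of
`ℍ^{-s}(Ω)` term by term. -/
theorem hasSum_eigenfun (v : B.Hs s) :
    HasSum (fun k => B.coeff (toL2 B s v) k • eigenfun B s k) v := by
  have h := lp.hasSum_single (p := 2) (by simp) (toSeq B s v)
  have h2 := h.mapL ((toSeqEquiv B s).symm.toContinuousLinearEquiv : _ →L[ℝ] B.Hs s)
  have e : (toSeqEquiv B s).symm (toSeq B s v) = v := (toSeqEquiv B s).symm_apply_apply v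
  convert! h2 using 1
  · funext k
    change _ = (toSeqEquiv B s).symm _
    rw [LinearIsometryEquiv.eq_symm_apply, toSeqEquiv_apply, map_smul, toSeq_eigenfun,
      ← lp.single_smul, toSeq_apply, smul_eq_mul, mul_comm]
    rfl
  · exact e.symm

theorem dual_ext {F G : Dual B s} (h : ∀ k, F (eigenfun B s k) = G (eigenfun B s k)) : F = G := by
  ext v
  have hF := (hasSum_eigenfun B s v).mapL F
  have hG := (hasSum_eigenfun B s v).mapL G
  refine hF.unique ?_
  convert! hG using 2 with k
  rw [map_smul, map_smul, h]

theorem ofL2_eigenfun (f : L2 P) (k : ℕ) : ofL2 B s f (eigenfun B s k) = B.coeff f k := by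
  rw [ofL2_apply, toL2_eigenfun, real_inner_comm, coeff]

theorem fracPow_eigenfun (w : B.Hs s) (k : ℕ) :
    fracPow B s w (eigenfun B s k) = B.eigval k ^ (s : ℝ) * B.coeff (toL2 B s w) k := by
  rw [fracPow_apply, tsum_eq_single k]
  · rw [toL2_eigenfun, coeff_basis, if_pos rfl, mul_one]
  · intro j hj
    rw [toL2_eigenfun, coeff_basis, if_neg hj, mul_zero]

end Hs

open Hs

/-! ### Solving mode by mode -/

variable {s : ℝ≥0} {T : ℝ}

theorem memLp_coeff {f : ℝ → L2 P} (hf : MemLp f 2 (timeMeasure T)) (k : ℕ) :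
    MemLp (fun t => B.coeff (f t) k) 2 (timeMeasure T) :=
  (B.coeffL k).comp_memLp' hf

theorem integrable_coeff {f : ℝ → L2 P} (hf : MemLp f 2 (timeMeasure T)) (k : ℕ) :
    Integrable (fun t => B.coeff (f t) k) (timeMeasure T) :=
  (B.memLp_coeff hf k).integrable (by norm_num)

/-- Parseval at each time, integrated by dominated convergence; the sum of the squares at time `t`
is `‖f t‖ ^ 2`, which is integrable. -/
theorem hasSum_integral_coeff_sq (f : Lp (L2 P) 2 (timeMeasure T)) :
    HasSum (fun k => ∫ t, B.coeff (f t) k ^ 2 ∂timeMeasure T) (‖f‖ ^ 2) := by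
  rw [norm_sq_eq_integral]
  have hi : Integrable (fun t => ‖f t‖ ^ 2) (timeMeasure T) :=
    (Lp.memLp f).integrable_norm_pow (by simp)
  refine hasSum_integral_of_dominated_convergence (fun k t => B.coeff (f t) k ^ 2)
    (fun k => ((B.memLp_coeff (Lp.memLp f) k).integrable_sq).aestronglyMeasurable)
    (fun k => Eventually.of_forall fun t => ?_)
    (Eventually.of_forall fun t => (B.hasSum_coeff_sq (f t)).summable) ?_
    (Eventually.of_forall fun t => B.hasSum_coeff_sq (f t))
  · rw [Real.norm_eq_abs, abs_of_nonneg (sq_nonneg _)]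
  · refine hi.congr (Eventually.of_forall fun t => ?_)
    exact (B.hasSum_coeff_sq (f t)).tsum_eq.symm

/-- The solution of the wave equation, built from its modes. -/
theorem exists_oscillation (hT : 0 < T) (f : Lp (L2 P) 2 (timeMeasure T)) (g : B.Hs s) (h : L2 P) :
    ∃ (U : ℝ → B.Hs s) (W : ℝ → L2 P), ContinuousOn U (Icc 0 T) ∧ ContinuousOn W (Icc 0 T) ∧
      (∀ t ∈ Icc 0 T, ‖U t‖ ^ 2 ≤ 2 * (‖h‖ ^ 2 + ‖g‖ ^ 2) + 4 * T * ‖f‖ ^ 2) ∧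
      (∀ t ∈ Icc 0 T, ‖W t‖ ^ 2 ≤ 2 * (‖h‖ ^ 2 + ‖g‖ ^ 2) + 4 * T * ‖f‖ ^ 2) ∧
      ∀ k, IsOscillation T (B.eigval k ^ (s : ℝ)) (fun t => B.coeff (f t) k)
        (B.coeff (toL2 B s g) k) (B.coeff h k) (fun t => B.coeff (toL2 B s (U t)) k)
        (fun t => B.coeff (W t) k) := by
  have hμ : ∀ k, 0 < B.eigval k ^ (s : ℝ) := fun k => Real.rpow_pos_of_pos (B.eigval_pos k) _
  have hfi := fun k => B.integrable_coeff (Lp.memLp f) k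
  choose v w H using fun k => IsOscillation.exists (hμ k) (hfi k) (B.coeff (toL2 B s g) k)
    (B.coeff h k)
  -- The right-hand side of the energy bound for mode `k`. It is independent of `t` and summable in
  -- `k`, so it serves both as the majorant for continuity in `ℓ²` and as the source of the final
  -- bound.
  let M : ℕ → ℝ := fun k => 2 * (B.coeff h k ^ 2 +
    B.eigval k ^ (s : ℝ) * B.coeff (toL2 B s g) k ^ 2) +
    4 * T * ∫ t, B.coeff (f t) k ^ 2 ∂timeMeasure T
  have hg := hasSum_inner_toSeq B s g g
  rw [real_inner_self_eq_norm_sq, norm_toSeq] at hg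
  simp only [mul_assoc, ← sq] at hg
  have hM : HasSum M (2 * (‖h‖ ^ 2 + ‖g‖ ^ 2) + 4 * T * ‖f‖ ^ 2) :=
    (((B.hasSum_coeff_sq h).add hg).mul_left 2).add ((B.hasSum_integral_coeff_sq f).mul_left _)
  have hE : ∀ t ∈ Icc 0 T, ∀ k, w k t ^ 2 + B.eigval k ^ (s : ℝ) * v k t ^ 2 ≤ M k := by
    intro t ht k
    have := (H k).energy_le hT (hμ k).le (intervalIntegrable_of_timeMeasure hT.le (hfi k))
      (intervalIntegrable_of_timeMeasure hT.le (B.memLp_coeff (Lp.memLp f) k).integrable_sq) ht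
    rwa [← integral_timeMeasure hT.le] at this
  obtain ⟨A, hAc, hA, hAb⟩ := exists_continuousOn_lp hM (S := Icc 0 T)
    (a := fun k t => B.eigval k ^ ((s : ℝ) / 2) * v k t)
    (fun k => (H k).continuousOn_fst.const_mul _) (fun t ht k => by
      have := hE t ht k
      rw [mul_pow, rpow_half_sq]
      nlinarith [sq_nonneg (w k t)])
  obtain ⟨D, hDc, hD, hDb⟩ := exists_continuousOn_lp hM (S := Icc 0 T)
    (a := w) (fun k => (H k).continuousOn_snd) (fun t ht k => by
      have := hE t ht k
      nlinarith [mul_nonneg (hμ k).le (sq_nonneg (v k t))])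
  refine ⟨fun t => (toSeqEquiv B s).symm (A t), fun t => B.basis.repr.symm (D t),
    (toSeqEquiv B s).symm.continuous.comp_continuousOn hAc,
    B.basis.repr.symm.continuous.comp_continuousOn hDc,
    fun t ht => ?_, fun t ht => ?_, fun k => (H k).congr_on (fun t ht => ?_) fun t ht => ?_⟩
  · rw [LinearIsometryEquiv.norm_map]
    exact hAb t ht
  · rw [LinearIsometryEquiv.norm_map]
    exact hDb t ht
  · have h1 := coeff_toSeqEquiv_symm B s (A t) k
    rw [hA t ht] at h1
    exact (mul_left_cancel₀ (Real.rpow_pos_of_pos (B.eigval_pos k) _).ne' h1).symm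
  · simp only [coeff_repr_symm, hD t ht]

end Eigenbasis

/-! ### Vector-valued weak time derivatives -/

section WeakDeriv

variable {X Y : Type*} [NormedAddCommGroup X] [NormedSpace ℝ X] [NormedAddCommGroup Y]
  [NormedSpace ℝ Y] {T : ℝ}

theorem integrable_smul_of_contDiff {φ : ℝ → ℝ} (hφ : Continuous φ)
    (hc : HasCompactSupport φ) {y : ℝ → X} (hy : Integrable y (timeMeasure T)) :
    Integrable (fun t => φ t • y t) (timeMeasure T) := by
  obtain ⟨K, hK⟩ := hφ.bounded_above_of_compact_support hc
  exact hy.bdd_smul K hφ.aestronglyMeasurable (Eventually.of_forall hK)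

theorem HasWeakTimeDeriv.map [CompleteSpace X] [CompleteSpace Y] {y z : ℝ → X}
    (h : HasWeakTimeDeriv T y z) (hy : Integrable y (timeMeasure T))
    (hz : Integrable z (timeMeasure T)) (L : X →L[ℝ] Y) :
    HasWeakTimeDeriv T (fun t => L (y t)) (fun t => L (z t)) := by
  intro φ hφ hc hs
  have h1 := congrArg L (h φ hφ hc hs)
  rw [map_neg, ← L.integral_comp_comm (integrable_smul_of_contDiff
    (hφ.continuous_deriv (by simp)) hc.deriv hy),
    ← L.integral_comp_comm (integrable_smul_of_contDiff hφ.continuous hc hz)] at h1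
  simpa only [map_smul] using h1

/-- Continuous functionals commute with the Bochner integral, so a separating family of them detects
the defining identity. -/
theorem hasWeakTimeDeriv_of_forall [CompleteSpace X] {ι : Type*} {y z : ℝ → X}
    (hy : Integrable y (timeMeasure T)) (hz : Integrable z (timeMeasure T)) (L : ι → X →L[ℝ] ℝ)
    (hL : ∀ x x' : X, (∀ i, L i x = L i x') → x = x')
    (h : ∀ i, HasWeakTimeDeriv T (fun t => L i (y t)) (fun t => L i (z t))) :
    HasWeakTimeDeriv T y z := by
  intro φ hφ hc hs
  refine hL _ _ fun i => ?_
  have h1 := h i φ hφ hc hs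
  rw [map_neg, ← (L i).integral_comp_comm (integrable_smul_of_contDiff
    (hφ.continuous_deriv (by simp)) hc.deriv hy),
    ← (L i).integral_comp_comm (integrable_smul_of_contDiff hφ.continuous hc hz)]
  simpa only [map_smul] using h1

theorem HasWeakTimeDeriv.congr {y z y' z' : ℝ → X} (h : HasWeakTimeDeriv T y z)
    (hy : y =ᵐ[timeMeasure T] y') (hz : z =ᵐ[timeMeasure T] z') : HasWeakTimeDeriv T y' z' := by
  intro φ hφ hc hs
  have e1 : ∫ t, deriv φ t • y' t ∂timeMeasure T = ∫ t, deriv φ t • y t ∂timeMeasure T :=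
    integral_congr_ae (by filter_upwards [hy] with t ht; rw [ht])
  have e2 : ∫ t, φ t • z' t ∂timeMeasure T = ∫ t, φ t • z t ∂timeMeasure T :=
    integral_congr_ae (by filter_upwards [hz] with t ht; rw [ht])
  rw [e1, e2, h φ hφ hc hs]

/-- The fundamental lemma of the calculus of variations applied to `z - z'`. -/
theorem HasWeakTimeDeriv.unique [CompleteSpace X] {y z z' : ℝ → X} (h : HasWeakTimeDeriv T y z)
    (h' : HasWeakTimeDeriv T y z') (hz : Integrable z (timeMeasure T))
    (hz' : Integrable z' (timeMeasure T)) : z =ᵐ[timeMeasure T] z' := by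
  have hloc : LocallyIntegrableOn (fun t => z t - z' t) (Ioo 0 T) volume :=
    IntegrableOn.locallyIntegrableOn (hz.sub hz')
  have hae := isOpen_Ioo.ae_eq_zero_of_integral_contDiff_smul_eq_zero hloc
    (fun φ hφ hc hs => by
      have e : ∫ t, φ t • (z t - z' t) = ∫ t, φ t • (z t - z' t) ∂timeMeasure T := by
        refine (setIntegral_eq_integral_of_forall_compl_eq_zero fun x hx => ?_).symm
        have : φ x = 0 := by
          by_contra hne
          exact hx (hs (subset_tsupport _ hne))
        rw [this, zero_smul]
      simp only [smul_sub] at e ⊢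
      rw [e, integral_sub (integrable_smul_of_contDiff hφ.continuous hc hz)
        (integrable_smul_of_contDiff hφ.continuous hc hz'),
        neg_injective ((h φ hφ hc hs).symm.trans (h' φ hφ hc hs)), sub_self])
  rw [EventuallyEq, timeMeasure, ae_restrict_iff' measurableSet_Ioo]
  filter_upwards [hae] with x hx hx'
  exact sub_eq_zero.mp (hx hx')

end WeakDeriv

theorem IsOscillation.hasWeakTimeDeriv_fst {T μ g h : ℝ} {f v w : ℝ → ℝ} (hT : 0 ≤ T)
    (H : IsOscillation T μ f g h v w) : HasWeakTimeDeriv T v w := by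
  intro φ hφ _ hs
  have hw : Integrable w (timeMeasure T) :=
    (H.continuousOn_snd.integrableOn_Icc (μ := volume)).mono_set Ioo_subset_Icc_self
  refine Eq.trans ?_ (integral_deriv_mul_primitive hT hw g hφ hs)
  refine setIntegral_congr_fun measurableSet_Ioo fun t ht => ?_
  simp only [smul_eq_mul, H.fst_eq t (Ioo_subset_Icc_self ht)]

theorem IsOscillation.hasWeakTimeDeriv_snd {T μ g h : ℝ} {f v w : ℝ → ℝ} (hT : 0 ≤ T)
    (H : IsOscillation T μ f g h v w) (hf : Integrable f (timeMeasure T)) :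
    HasWeakTimeDeriv T w (fun t => f t - μ * v t) := by
  intro φ hφ _ hs
  have hv : Integrable v (timeMeasure T) :=
    (H.continuousOn_fst.integrableOn_Icc (μ := volume)).mono_set Ioo_subset_Icc_self
  refine Eq.trans ?_ (integral_deriv_mul_primitive hT (hf.sub (hv.const_mul μ)) h hφ hs)
  refine setIntegral_congr_fun measurableSet_Ioo fun t ht => ?_
  simp only [smul_eq_mul, H.snd_eq t (Ioo_subset_Icc_self ht), Pi.sub_apply]

theorem memLp_timeMeasure_of_continuousOn {X : Type*} [NormedAddCommGroup X] {T : ℝ} {U : ℝ → X}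
    (hU : ContinuousOn U (Icc 0 T)) : MemLp U 2 (timeMeasure T) := by
  obtain ⟨K, hK⟩ := isCompact_Icc.exists_bound_of_continuousOn hU
  refine MemLp.of_bound ?_ K ?_
  · exact (hU.mono Ioo_subset_Icc_self).aestronglyMeasurable measurableSet_Ioo
  · rw [timeMeasure, ae_restrict_iff' measurableSet_Ioo]
    exact Eventually.of_forall fun t ht => hK t (Ioo_subset_Icc_self ht)

theorem eLpNorm_top_le_of_continuousOn {X : Type*} [NormedAddCommGroup X] {T K : ℝ} {U u : ℝ → X}
    (hu : u =ᵐ[timeMeasure T] U) (hU : ∀ t ∈ Icc 0 T, ‖U t‖ ≤ K) :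
    eLpNorm u ∞ (timeMeasure T) ≤ ENNReal.ofReal K := by
  rw [eLpNorm_congr_ae hu, eLpNorm_exponent_top]
  refine eLpNormEssSup_le_of_ae_bound ?_
  rw [timeMeasure, ae_restrict_iff' measurableSet_Ioo]
  exact Eventually.of_forall fun t ht => hU t (Ioo_subset_Icc_self ht)

/-! ### Weak solutions of the wave equation: existence, uniqueness, estimate -/

section Wave

open Eigenbasis Eigenbasis.Hs

variable {P : EllipticOperator n} {B : Eigenbasis P} {s : ℝ≥0} {T : ℝ}
  {f : Lp (L2 P) 2 (timeMeasure T)} {g : B.Hs s} {h : L2 P} {U : ℝ → B.Hs s} {W : ℝ → L2 P}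

theorem hasWeakTimeDeriv_of_isOscillation (hT : 0 ≤ T) (hU : ContinuousOn U (Icc 0 T))
    (hW : ContinuousOn W (Icc 0 T))
    (H : ∀ k, IsOscillation T (B.eigval k ^ (s : ℝ)) (fun t => B.coeff (f t) k)
        (B.coeff (toL2 B s g) k) (B.coeff h k) (fun t => B.coeff (toL2 B s (U t)) k)
        (fun t => B.coeff (W t) k)) :
    HasWeakTimeDeriv T (fun t => toL2 B s (U t)) W :=
  hasWeakTimeDeriv_of_forall
    ((memLp_timeMeasure_of_continuousOn
      ((toL2 B s).continuous.comp_continuousOn hU)).integrable (by norm_num))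
    ((memLp_timeMeasure_of_continuousOn hW).integrable (by norm_num))
    B.coeffL (fun _ _ hx => B.eq_of_coeff_eq hx) fun k => (H k).hasWeakTimeDeriv_fst hT

/-- The second derivative is defined as `f - 𝓛^s U` in `L²(0,T;ℍ^{-s}(Ω))`, so the equation itself
holds by construction. What remains is that this is the weak derivative of `W`, which is checked on
eigenfunctions, where it is the scalar equation. -/
theorem isWeakSolution_of_isOscillation (hT : 0 < T) (hU : ContinuousOn U (Icc 0 T))
    (hW : ContinuousOn W (Icc 0 T))
    (H : ∀ k, IsOscillation T (B.eigval k ^ (s : ℝ)) (fun t => B.coeff (f t) k)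
        (B.coeff (toL2 B s g) k) (B.coeff h k) (fun t => B.coeff (toL2 B s (U t)) k)
        (fun t => B.coeff (W t) k)) :
    IsWeakSolution B s T f g h ((memLp_timeMeasure_of_continuousOn hU).toLp U) := by
  have mU := memLp_timeMeasure_of_continuousOn hU
  have mW := memLp_timeMeasure_of_continuousOn hW
  have eU := mU.coeFn_toLp
  have eW := mW.coeFn_toLp
  have z0 : (0 : ℝ) ∈ Icc 0 T := ⟨le_rfl, hT.le⟩
  have mD : MemLp (fun t => ofL2 B s (f t) - fracPow B s (U t)) 2 (timeMeasure T) :=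
    ((ofL2 B s).comp_memLp' (Lp.memLp f)).sub ((fracPow B s).comp_memLp' mU)
  refine ⟨mW.toLp W, mD.toLp _, ?_, ?_, ?_, ?_, ?_⟩
  · refine (hasWeakTimeDeriv_of_isOscillation hT.le hU hW H).congr ?_ eW.symm
    filter_upwards [eU] with t ht
    rw [ht]
  · refine HasWeakTimeDeriv.congr (y := fun t => ofL2 B s (W t))
      (z := fun t => ofL2 B s (f t) - fracPow B s (U t)) ?_ ?_ mD.coeFn_toLp.symm
    · refine hasWeakTimeDeriv_of_forall (((ofL2 B s).comp_memLp' mW).integrable (by norm_num))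
        (mD.integrable (by norm_num))
        (fun k => ContinuousLinearMap.apply ℝ ℝ (eigenfun B s k))
        (fun _ _ hx => dual_ext B s hx) fun k => ?_
      have := (H k).hasWeakTimeDeriv_snd hT.le (B.integrable_coeff (Lp.memLp f) k)
      simpa only [ContinuousLinearMap.apply_apply, sub_apply, ofL2_eigenfun,
        fracPow_eigenfun] using this
    · filter_upwards [eW] with t ht
      rw [ht]
  · refine ⟨fun t => toL2 B s (U t), (toL2 B s).continuous.comp_continuousOn hU, ?_, ?_⟩
    · filter_upwards [eU] with t ht
      rw [ht]
    · refine B.eq_of_coeff_eq fun k => ?_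
      simpa using (H k).fst_eq 0 z0
  · refine ⟨fun t => ofL2 B s (W t), (ofL2 B s).continuous.comp_continuousOn hW, ?_, ?_⟩
    · filter_upwards [eW] with t ht
      rw [ht]
    · refine congrArg (ofL2 B s) (B.eq_of_coeff_eq fun k => ?_)
      simpa using (H k).snd_eq 0 z0
  · filter_upwards [eU, mD.coeFn_toLp] with t h1 h2 v
    rw [h1, h2, sub_apply]
    ring

/-- Pairing the weak formulation with the `k`-th eigenfunction makes the coefficient of `u` an
oscillation with the same data as that of `U`, so scalar uniqueness applies mode by mode. Using `u'`
itself as a multiplier is thus avoided; it takes values only in `L²(Ω)`, whereas test vectors must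
lie in `ℍ^s(Ω)`. -/
theorem IsWeakSolution.ae_eq {u : Lp (B.Hs s) 2 (timeMeasure T)} (hu : IsWeakSolution B s T f g h u)
    (hT : 0 < T)
    (H : ∀ k, IsOscillation T (B.eigval k ^ (s : ℝ)) (fun t => B.coeff (f t) k)
        (B.coeff (toL2 B s g) k) (B.coeff h k) (fun t => B.coeff (toL2 B s (U t)) k)
        (fun t => B.coeff (W t) k)) :
    u =ᵐ[timeMeasure T] U := by
  obtain ⟨u', u'', h1, h2, ⟨V, hVc, hV, hV0⟩, ⟨Z, hZc, hZ, hZ0⟩, heq⟩ := hu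
  have mu : MemLp (fun t => toL2 B s (u t)) 2 (timeMeasure T) :=
    (toL2 B s).comp_memLp' (Lp.memLp u)
  have iu' : Integrable u' (timeMeasure T) := (Lp.memLp u').integrable (by norm_num)
  have iu'' : Integrable u'' (timeMeasure T) := (Lp.memLp u'').integrable (by norm_num)
  have key : ∀ k, ∀ᵐ t ∂timeMeasure T,
      B.coeff (toL2 B s (u t)) k = B.coeff (toL2 B s (U t)) k := by
    intro k
    have hVk : ContinuousOn (fun t => B.coeff (V t) k) (Icc 0 T) :=
      (B.coeffL k).continuous.comp_continuousOn hVc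
    have hZk : ContinuousOn (fun t => Z t (eigenfun B s k)) (Icc 0 T) :=
      (ContinuousLinearMap.apply ℝ ℝ (eigenfun B s k)).continuous.comp_continuousOn hZc
    have eV : (fun t => B.coeff (toL2 B s (u t)) k) =ᵐ[timeMeasure T] fun t => B.coeff (V t) k := by
      filter_upwards [hV] with t ht
      rw [ht]
    -- The given continuous representative of `u'` lives only in `ℍ^{-s}(Ω)`; its pairing with an
    -- eigenfunction still provides a continuous representative of the scalar coefficient.
    have eZ : (fun t => B.coeff (u' t) k) =ᵐ[timeMeasure T] fun t => Z t (eigenfun B s k) := by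
      filter_upwards [hZ] with t ht
      rw [← ht, ofL2_eigenfun]
    have d1 := h1.map (mu.integrable (by norm_num)) iu' (B.coeffL k)
    have d2 := h2.map ((ofL2 B s).integrable_comp iu') iu''
      (ContinuousLinearMap.apply ℝ ℝ (eigenfun B s k))
    simp only [coeffL_apply, ContinuousLinearMap.apply_apply, ofL2_eigenfun] at d1 d2
    have d1' := d1.congr EventuallyEq.rfl eZ
    have d2' : HasWeakTimeDeriv T (fun t => B.coeff (u' t) k)
        (fun t => B.coeff (f t) k - B.eigval k ^ (s : ℝ) * B.coeff (V t) k) := by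
      refine d2.congr EventuallyEq.rfl ?_
      filter_upwards [heq, eV] with t ht1 ht2
      have := ht1 (eigenfun B s k)
      rw [ofL2_eigenfun, fracPow_eigenfun] at this
      rw [← ht2]
      linarith
    have iVk := (memLp_timeMeasure_of_continuousOn hVk).integrable (q := 2) (by norm_num)
    have hosc : IsOscillation T (B.eigval k ^ (s : ℝ)) (fun t => B.coeff (f t) k)
        (B.coeff (toL2 B s g) k) (B.coeff h k) (fun t => B.coeff (V t) k)
        (fun t => Z t (eigenfun B s k)) := by
      refine ⟨hVk, hZk, fun t ht => ?_, fun t ht => ?_⟩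
      · have := d1'.eq_add_integral hT.le
          ((memLp_timeMeasure_of_continuousOn hZk).integrable (by norm_num)) hVk eV ht
        simpa only [hV0] using this
      · have := d2'.eq_add_integral hT.le
          ((B.integrable_coeff (Lp.memLp f) k).sub (iVk.const_mul _)) hZk eZ ht
        simpa only [hZ0, ofL2_eigenfun] using this
    have hIoo : ∀ᵐ t ∂timeMeasure T, t ∈ Ioo 0 T := ae_restrict_mem measurableSet_Ioo
    filter_upwards [eV, hIoo] with t ht1 ht2
    rw [ht1]
    exact (hosc.unique (H k) (Real.rpow_pos_of_pos (B.eigval_pos k) _)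
      (intervalIntegrable_of_timeMeasure hT.le (B.integrable_coeff (Lp.memLp f) k))
      (Ioo_subset_Icc_self ht2)).1
  filter_upwards [ae_all_iff.mpr key] with t ht
  exact incl_injective B s (B.eq_of_coeff_eq ht)

/-- Well-posedness of the fractional wave equation and the energy estimate. -/
theorem wave_wellPosed (hT : 0 < T) (f : Lp (L2 P) 2 (timeMeasure T)) (g : B.Hs s) (h : L2 P) :
    (∃! u : Lp (B.Hs s) 2 (timeMeasure T), IsWeakSolution B s T f g h u) ∧
    ∀ (u : Lp (B.Hs s) 2 (timeMeasure T)) (u' : Lp (L2 P) 2 (timeMeasure T)),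
      IsWeakSolution B s T f g h u →
      HasWeakTimeDeriv T (fun t => toL2 B s (u t)) u' →
      eLpNorm u ∞ (timeMeasure T) + eLpNorm u' ∞ (timeMeasure T) ≤
        ENNReal.ofReal (4 * (1 + √T) * (‖f‖ + ‖g‖ + ‖h‖)) := by
  obtain ⟨U, W, hU, hW, hUb, hWb, H⟩ := B.exists_oscillation hT f g h
  refine ⟨⟨_, isWeakSolution_of_isOscillation hT hU hW H, fun u hu => ?_⟩, fun u u' hu hu' => ?_⟩
  · exact Lp.ext ((hu.ae_eq hT H).trans (memLp_timeMeasure_of_continuousOn hU).coeFn_toLp.symm)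
  · have e1 := hu.ae_eq hT H
    have e2 : u' =ᵐ[timeMeasure T] W := by
      refine HasWeakTimeDeriv.unique hu'
        ((hasWeakTimeDeriv_of_isOscillation hT.le hU hW H).congr ?_ EventuallyEq.rfl)
        ((Lp.memLp u').integrable (by norm_num))
        ((memLp_timeMeasure_of_continuousOn hW).integrable (q := 2) (by norm_num))
      filter_upwards [e1] with t ht
      rw [ht]
    -- The left side is at most `4 (1 + T)` times the sum of the three squares, and `1 + T ≤ (1 +
    -- √T)²`. Taking roots bounds each of the two norms by `2 (1 + √T) (‖f‖ + ‖g‖ + ‖h‖)`, whence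
    -- the constant `4 (1 + √T)` for their sum.
    have hsum : 2 * (‖h‖ ^ 2 + ‖g‖ ^ 2) + 4 * T * ‖f‖ ^ 2 ≤
        (2 * (1 + √T) * (‖f‖ + ‖g‖ + ‖h‖)) ^ 2 := by
      have hf0 := norm_nonneg f
      have hg0 := norm_nonneg g
      have hh0 := norm_nonneg h
      have hs0 := Real.sqrt_nonneg T
      have hsq := Real.sq_sqrt hT.le
      set r := √T
      have a0 : 4 * T * ‖f‖ ^ 2 = 4 * r ^ 2 * ‖f‖ ^ 2 := congrArg (4 * · * ‖f‖ ^ 2) hsq.symm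
      rw [a0]
      have a1 : ‖h‖ ^ 2 + ‖g‖ ^ 2 + ‖f‖ ^ 2 ≤ (‖f‖ + ‖g‖ + ‖h‖) ^ 2 := by
        nlinarith [mul_nonneg hf0 hg0, mul_nonneg hf0 hh0, mul_nonneg hg0 hh0]
      have a2 : 1 + r ^ 2 ≤ (1 + r) ^ 2 := by nlinarith
      have a3 := mul_le_mul a2 a1 (by positivity) (by positivity)
      have a4 : 0 ≤ r ^ 2 * (‖h‖ ^ 2 + ‖g‖ ^ 2) := by positivity
      nlinarith [sq_nonneg ‖h‖, sq_nonneg ‖g‖, sq_nonneg ‖f‖]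
    have hb0 : 0 ≤ 2 * (1 + √T) * (‖f‖ + ‖g‖ + ‖h‖) := by positivity
    have n1 := eLpNorm_top_le_of_continuousOn e1 fun t ht =>
      (abs_le_of_sq_le_sq' ((hUb t ht).trans hsum) hb0).2
    have n2 := eLpNorm_top_le_of_continuousOn e2 fun t ht =>
      (abs_le_of_sq_le_sq' ((hWb t ht).trans hsum) hb0).2
    refine (add_le_add n1 n2).trans ?_
    rw [← ENNReal.ofReal_add hb0 hb0]
    refine ENNReal.ofReal_le_ofReal (le_of_eq ?_)
    ring

end Wave

/-! ### Compactness of `H¹₀(Ω) ↪ L²(Ω)` -/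

/-- Cauchy–Schwarz against the constant one, read off from the nonnegative integral of the square of
`ν(univ) q - ∫ q`. -/
theorem sq_integral_le {α : Type*} [MeasurableSpace α] {ν : Measure α} [IsFiniteMeasure ν]
    {q : α → ℝ} (hq : MemLp q 2 ν) : (∫ x, q x ∂ν) ^ 2 ≤ ν.real univ * ∫ x, q x ^ 2 ∂ν := by
  have i1 : Integrable q ν := hq.integrable (by norm_num)
  have i2 : Integrable (fun x => q x ^ 2) ν := hq.integrable_sq
  rcases eq_or_lt_of_le (measureReal_nonneg : 0 ≤ ν.real univ) with h | h
  · have : ν = 0 := by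
      rw [← Measure.measure_univ_eq_zero, ← measureReal_eq_zero_iff, ← h]
    simp [this]
  · have h0 : 0 ≤ ∫ x, (ν.real univ * q x - ∫ y, q y ∂ν) ^ 2 ∂ν :=
      integral_nonneg fun x => sq_nonneg _
    have e : ∫ x, (ν.real univ * q x - ∫ y, q y ∂ν) ^ 2 ∂ν =
        ∫ x, (ν.real univ ^ 2 * q x ^ 2 - 2 * ν.real univ * (∫ y, q y ∂ν) * q x +
          (∫ y, q y ∂ν) ^ 2) ∂ν := integral_congr_ae (Eventually.of_forall fun x => by
      ring)
    rw [e, integral_add (by fun_prop) (integrable_const _),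
      integral_sub (i2.const_mul _) (i1.const_mul _), integral_const_mul, integral_const_mul,
      integral_const, smul_eq_mul] at h0
    have h1 : 0 ≤ ν.real univ * (ν.real univ * ∫ x, q x ^ 2 ∂ν - (∫ x, q x ∂ν) ^ 2) := by
      nlinarith
    have := nonneg_of_mul_nonneg_right h1 h
    linarith

theorem ofReal_sq_integral_le {α : Type*} [MeasurableSpace α] {ν : Measure α} [IsFiniteMeasure ν]
    {q : α → ℝ} (hq : MemLp q 2 ν) :
    ENNReal.ofReal ((∫ x, q x ∂ν) ^ 2) ≤ ν univ * ∫⁻ x, ENNReal.ofReal (q x ^ 2) ∂ν := by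
  refine (ENNReal.ofReal_le_ofReal (sq_integral_le hq)).trans ?_
  rw [ENNReal.ofReal_mul measureReal_nonneg, ofReal_measureReal,
    ofReal_integral_eq_lintegral_ofReal hq.integrable_sq
      (Eventually.of_forall fun x => sq_nonneg _)]

section Translation

variable {E : Type*} [NormedAddCommGroup E] [InnerProductSpace ℝ E] [CompleteSpace E]
  {φ : E → ℝ}

theorem continuous_gradient (hφ : ContDiff ℝ ∞ φ) : Continuous (gradient φ) := by
  unfold gradient
  exact (LinearIsometryEquiv.continuous _).comp (hφ.continuous_fderiv (by simp))

variable [FiniteDimensional ℝ E] [MeasurableSpace E] [BorelSpace E]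

/-- Write the increment as the integral of `∇φ(x + t h) · h` over `t ∈ (0, 1]`, apply Cauchy–Schwarz
in `t`, exchange the integrals by Tonelli, and use translation invariance in `x`. -/
theorem lintegral_translate_sub_sq_le (hφ : ContDiff ℝ ∞ φ) (h : E) :
    ∫⁻ x, ENNReal.ofReal ((φ x - φ (x + h)) ^ 2) ≤
      ENNReal.ofReal (‖h‖ ^ 2) * ∫⁻ x, ENNReal.ofReal (‖gradient φ x‖ ^ 2) := by
  have hgc := continuous_gradient hφ
  have hgm : Measurable fun x => ENNReal.ofReal (‖gradient φ x‖ ^ 2) := by fun_prop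
  have pt : ∀ x, ENNReal.ofReal ((φ x - φ (x + h)) ^ 2) ≤
      ∫⁻ t in Ioc (0 : ℝ) 1, ENNReal.ofReal (‖h‖ ^ 2) *
        ENNReal.ofReal (‖gradient φ (x + t • h)‖ ^ 2) := by
    intro x
    have hd : ∀ t : ℝ, HasDerivAt (fun t : ℝ => φ (x + t • h))
        (inner ℝ (gradient φ (x + t • h)) h) t := fun t => by
      have h1 : HasDerivAt (fun t : ℝ => x + t • h) h t := by
        simpa using ((hasDerivAt_id t).smul_const h).const_add x
      have h2 := ((hφ.differentiable (by simp)) (x + t • h)).hasFDerivAt.comp_hasDerivAt t h1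
      have e : inner ℝ (gradient φ (x + t • h)) h = fderiv ℝ φ (x + t • h) h := by simp [gradient]
      rw [e]
      exact h2
    have hc : Continuous fun t : ℝ => inner ℝ (gradient φ (x + t • h)) h := by fun_prop
    have e := intervalIntegral.integral_eq_sub_of_hasDerivAt (a := 0) (b := 1) (fun t _ => hd t)
      (hc.intervalIntegrable _ _)
    simp only [one_smul, zero_smul, add_zero] at e
    rw [intervalIntegral.integral_of_le zero_le_one] at e
    rw [← neg_sub, neg_sq, ← e]
    have hm : MemLp (fun t : ℝ => inner ℝ (gradient φ (x + t • h)) h) 2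
        (volume.restrict (Ioc (0 : ℝ) 1)) := by
      obtain ⟨K, hK⟩ := isCompact_Icc.exists_bound_of_continuousOn (s := Icc (0 : ℝ) 1)
        hc.continuousOn
      refine MemLp.of_bound hc.aestronglyMeasurable K ?_
      filter_upwards [ae_restrict_mem measurableSet_Ioc] with t ht
      exact hK t (Ioc_subset_Icc_self ht)
    refine (ofReal_sq_integral_le hm).trans ?_
    simp only [Measure.restrict_apply_univ, Real.volume_Ioc, sub_zero, ENNReal.ofReal_one, one_mul]
    refine lintegral_mono fun t => ?_
    rw [← ENNReal.ofReal_mul (by positivity)]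
    refine ENNReal.ofReal_le_ofReal ?_
    have := abs_real_inner_le_norm (gradient φ (x + t • h)) h
    rw [← sq_abs, ← mul_pow, mul_comm]
    gcongr
  refine (lintegral_mono pt).trans ?_
  rw [lintegral_lintegral_swap]
  · have : ∀ t : ℝ, ∫⁻ x, ENNReal.ofReal (‖h‖ ^ 2) *
        ENNReal.ofReal (‖gradient φ (x + t • h)‖ ^ 2) =
        ENNReal.ofReal (‖h‖ ^ 2) * ∫⁻ x, ENNReal.ofReal (‖gradient φ x‖ ^ 2) := fun t => by
      rw [lintegral_const_mul' _ _ ENNReal.ofReal_ne_top,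
        lintegral_add_right_eq_self (fun x => ENNReal.ofReal (‖gradient φ x‖ ^ 2)) (t • h)]
    simp only [this, lintegral_const, Measure.restrict_apply_univ, Real.volume_Ioc, sub_zero,
      ENNReal.ofReal_one, mul_one, le_refl]
  · refine Continuous.aemeasurable ?_
    refine ENNReal.continuous_const_mul ENNReal.ofReal_ne_top |>.comp ?_
    refine ENNReal.continuous_ofReal.comp ?_
    fun_prop

/-- The `L²` distance of a smooth function to its averages over cells of equal volume `V`. -/
theorem lintegral_sub_average_sq_le (hφ : ContDiff ℝ ∞ φ) (hc : HasCompactSupport φ)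
    {Q : E → Set E} {D : Set E} {V : ℝ≥0∞} {r : ℝ} (hQ : ∀ x, MeasurableSet (Q x))
    (hV : ∀ x, volume (Q x) = V) (hV0 : V ≠ 0) (hVtop : V ≠ ⊤) (hD : MeasurableSet D)
    (hQD : ∀ x, ∀ y ∈ Q x, y - x ∈ D) (hDr : ∀ h ∈ D, ‖h‖ ≤ r) :
    ∫⁻ x, ENNReal.ofReal ((φ x - V.toReal⁻¹ * ∫ y in Q x, φ y) ^ 2) ≤
      V⁻¹ * volume D * ENNReal.ofReal (r ^ 2) * ∫⁻ x, ENNReal.ofReal (‖gradient φ x‖ ^ 2) := by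
  obtain ⟨K, hK⟩ := hφ.continuous.bounded_above_of_compact_support hc
  have hVr : 0 < V.toReal := ENNReal.toReal_pos hV0 hVtop
  have pt : ∀ x, ENNReal.ofReal ((φ x - V.toReal⁻¹ * ∫ y in Q x, φ y) ^ 2) ≤
      V⁻¹ * ∫⁻ h in D, ENNReal.ofReal ((φ x - φ (x + h)) ^ 2) := by
    intro x
    have : IsFiniteMeasure (volume.restrict (Q x)) := ⟨by
      rw [Measure.restrict_apply_univ, hV]
      exact hVtop.lt_top⟩
    have hm : MemLp (fun y => φ x - φ y) 2 (volume.restrict (Q x)) := by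
      refine MemLp.of_bound (continuous_const.sub hφ.continuous).aestronglyMeasurable (K + K)
        (Eventually.of_forall fun y => (norm_sub_le _ _).trans (add_le_add (hK x) (hK y)))
    have hi : Integrable φ (volume.restrict (Q x)) :=
      (hφ.continuous.integrable_of_hasCompactSupport hc).mono_measure Measure.restrict_le_self
    have e : φ x - V.toReal⁻¹ * ∫ y in Q x, φ y = V.toReal⁻¹ * ∫ y in Q x, (φ x - φ y) := by
      rw [integral_sub (integrable_const _) hi, setIntegral_const, measureReal_def, hV, smul_eq_mul]
      field_simp
    have h1 := ofReal_sq_integral_le hm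
    rw [Measure.restrict_apply_univ, hV] at h1
    -- Substituting `y = x + h` and enlarging the domain to `D` replaces a region depending on `x`
    -- by a fixed one, so that the order of integration can be exchanged and the translation
    -- estimate used for each `h`.
    have h2 : ∫⁻ y in Q x, ENNReal.ofReal ((φ x - φ y) ^ 2) ≤
        ∫⁻ h in D, ENNReal.ofReal ((φ x - φ (x + h)) ^ 2) := by
      rw [← lintegral_indicator (hQ x), ← lintegral_indicator hD,
        ← lintegral_add_left_eq_self (μ := volume)
          ((Q x).indicator fun y => ENNReal.ofReal ((φ x - φ y) ^ 2)) x]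
      refine lintegral_mono fun h => ?_
      by_cases hx : x + h ∈ Q x
      · have hh : h ∈ D := by simpa using hQD x _ hx
        rw [indicator_of_mem hx, indicator_of_mem hh]
      · rw [indicator_of_notMem hx]
        exact zero_le
    rw [e, mul_pow, ENNReal.ofReal_mul (by positivity)]
    have h3 : ENNReal.ofReal (V.toReal⁻¹ ^ 2) = V⁻¹ * V⁻¹ := by
      rw [sq, ENNReal.ofReal_mul (by positivity), ENNReal.ofReal_inv_of_pos hVr,
        ENNReal.ofReal_toReal hVtop]
    calc _ ≤ V⁻¹ * V⁻¹ * (V * ∫⁻ y in Q x, ENNReal.ofReal ((φ x - φ y) ^ 2)) := by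
          rw [h3]
          gcongr
      _ = V⁻¹ * (V⁻¹ * V) * ∫⁻ y in Q x, ENNReal.ofReal ((φ x - φ y) ^ 2) := by ring
      _ ≤ _ := by
          rw [ENNReal.inv_mul_cancel hV0 hVtop, mul_one]
          gcongr
  have hcont : Continuous fun p : E × E => ENNReal.ofReal ((φ p.1 - φ (p.1 + p.2)) ^ 2) := by
    refine ENNReal.continuous_ofReal.comp ?_
    have := hφ.continuous
    fun_prop
  calc _ ≤ ∫⁻ x, V⁻¹ * ∫⁻ h in D, ENNReal.ofReal ((φ x - φ (x + h)) ^ 2) := lintegral_mono pt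
    _ = V⁻¹ * ∫⁻ h in D, ∫⁻ x, ENNReal.ofReal ((φ x - φ (x + h)) ^ 2) := by
      rw [lintegral_const_mul' _ _ (ENNReal.inv_ne_top.mpr hV0), lintegral_lintegral_swap]
      exact hcont.aemeasurable
    _ ≤ V⁻¹ * ∫⁻ _ in D, ENNReal.ofReal (r ^ 2) *
        ∫⁻ x, ENNReal.ofReal (‖gradient φ x‖ ^ 2) := by
      refine mul_le_mul_right ?_ _
      refine setLIntegral_mono' hD fun h hh => (lintegral_translate_sub_sq_le hφ h).trans ?_
      have := hDr h hh
      gcongr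
    _ = _ := by
      rw [setLIntegral_const]
      ring

end Translation

/-! ### Grid averages and the approximation of the inclusion by finite-rank operators -/

/-- The cell with index `k` of the grid of width `ε`. -/
def gridCell (ε : ℝ) (k : Fin n → ℤ) : Set (EuclideanSpace ℝ (Fin n)) :=
  {x | ∀ i, x i ∈ Ico (k i * ε) (k i * ε + ε)}

/-- The index of the grid cell that contains `x`. -/
def gridIndex (ε : ℝ) (x : EuclideanSpace ℝ (Fin n)) : Fin n → ℤ := fun i => ⌊x i / ε⌋

theorem mem_gridCell_iff {ε : ℝ} (hε : 0 < ε) {k : Fin n → ℤ} {x : EuclideanSpace ℝ (Fin n)} :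
    x ∈ gridCell ε k ↔ gridIndex ε x = k := by
  rw [funext_iff]
  refine forall_congr' fun i => ?_
  rw [gridIndex, Int.floor_eq_iff, le_div_iff₀ hε, div_lt_iff₀ hε, add_mul, one_mul, mem_Ico]

theorem volume_setOf_forall_mem (I : Fin n → Set ℝ) (hI : ∀ i, MeasurableSet (I i)) :
    MeasurableSet {x : EuclideanSpace ℝ (Fin n) | ∀ i, x i ∈ I i} ∧
      volume {x : EuclideanSpace ℝ (Fin n) | ∀ i, x i ∈ I i} = ∏ i, volume (I i) := by
  have e : {x : EuclideanSpace ℝ (Fin n) | ∀ i, x i ∈ I i} =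
      WithLp.ofLp ⁻¹' (univ.pi I) := by
    ext x
    simp
  have hm : MeasurableSet (univ.pi I) := MeasurableSet.univ_pi hI
  have hp := PiLp.volume_preserving_ofLp (Fin n)
  rw [e]
  exact ⟨hp.measurable hm, by rw [hp.measure_preimage hm.nullMeasurableSet, volume_pi_pi]⟩

theorem volume_gridCell (ε : ℝ) (k : Fin n → ℤ) :
    MeasurableSet (gridCell ε k) ∧ volume (gridCell ε k) = ENNReal.ofReal ε ^ n := by
  have h := volume_setOf_forall_mem (fun i => Ico (k i * ε) (k i * ε + ε))
    fun i => measurableSet_Ico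
  refine ⟨h.1, h.2.trans ?_⟩
  simp

/-- A bounded set meets only finitely many cells; this makes averaging over cells an operator of
finite rank. -/
theorem gridIndex_mem_Icc {ε R : ℝ} (hε : 0 < ε) {x : EuclideanSpace ℝ (Fin n)} (hx : ‖x‖ ≤ R) :
    gridIndex ε x ∈ Finset.Icc (fun _ : Fin n => -⌈R / ε⌉) (fun _ => ⌈R / ε⌉) := by
  rw [Finset.mem_Icc]
  have h1 : ∀ i, |x i / ε| ≤ ⌈R / ε⌉ := fun i => by
    rw [abs_div, abs_of_pos hε]
    refine le_trans ?_ (Int.le_ceil _)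
    have : |x i| ≤ ‖x‖ := PiLp.norm_apply_le x i
    gcongr
    exact this.trans hx
  constructor
  · intro i
    simp only [gridIndex]
    rw [Int.le_floor]
    push_cast
    exact (abs_le.mp (h1 i)).1
  · intro i
    have h2 := (Int.floor_le (x i / ε)).trans (abs_le.mp (h1 i)).2
    exact Int.cast_le.mp h2

theorem ofReal_norm_sq_eq_lintegral {α F : Type*} [MeasurableSpace α] {μ : Measure α}
    [NormedAddCommGroup F] [InnerProductSpace ℝ F] (w : Lp F 2 μ) :
    ENNReal.ofReal (‖w‖ ^ 2) = ∫⁻ x, ENNReal.ofReal (‖w x‖ ^ 2) ∂μ := by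
  rw [norm_sq_eq_integral, ofReal_integral_eq_lintegral_ofReal
    ((Lp.memLp w).integrable_norm_pow (by simp)) (Eventually.of_forall fun x => by positivity)]

/-- On `H¹₀(Ω)`, the inclusion in `L²(Ω)` is approximated by compact operators. -/
theorem exists_isCompactOperator_approx (P : EllipticOperator n) {δ : ℝ} (hδ : 0 < δ) :
    ∃ K : L2 P →L[ℝ] L2 P, IsCompactOperator K ∧ ∀ p ∈ H10 P, ‖p.1 - K p.1‖ ≤ δ * ‖p.2‖ := by
  obtain ⟨R, hR, hΩ⟩ := P.bounded.exists_pos_norm_le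
  have hfin : volume P.Ω ≠ ⊤ := P.bounded.measure_lt_top.ne
  have : IsFiniteMeasure (volume.restrict P.Ω) := ⟨by
    rw [Measure.restrict_apply_univ]
    exact hfin.lt_top⟩
  -- Differences of points in one cell lie in the cube `[-ε, ε]^n`, whose volume is `2 ^ n` times
  -- that of a cell and whose vectors have squared length at most `n ε²`. The product of these two
  -- factors is the constant in the averaging estimate.
  obtain ⟨ε, hε, hεδ⟩ : ∃ ε > 0, 2 ^ n * (n * ε ^ 2) ≤ δ ^ 2 := by
    refine ⟨δ / (2 ^ n * n + 1), by positivity, ?_⟩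
    rw [div_pow, ← mul_assoc, mul_div_assoc', div_le_iff₀ (by positivity), mul_comm]
    have : (0 : ℝ) ≤ 2 ^ n * n := by positivity
    gcongr
    nlinarith
  set c : ℝ := (ENNReal.ofReal ε ^ n).toReal⁻¹ with hc
  let χ : (Fin n → ℤ) → L2 P := fun k =>
    indicatorConstLp 2 (volume_gridCell ε k).1 (measure_ne_top (volume.restrict P.Ω) _) (1 : ℝ)
  let S := Finset.Icc (fun _ : Fin n => -⌈R / ε⌉) (fun _ => ⌈R / ε⌉)
  -- Averaging over grid cells, as a finite sum of rank-one operators; `c` is the reciprocal of the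
  -- volume of a cell.
  let K : L2 P →L[ℝ] L2 P := ∑ k ∈ S,
    (ContinuousLinearMap.toSpanSingleton ℝ (c • χ k)).comp (innerSL ℝ (χ k))
  have hK : IsCompactOperator K := by
    have : K ∈ compactOperator (RingHom.id ℝ) (L2 P) (L2 P) :=
      Submodule.sum_mem _ fun k _ => by
        have h := (isCompactOperator_of_locallyCompactSpace_dom
          (innerSL ℝ (χ k) : L2 P →L[ℝ] ℝ)).clm_comp
            (ContinuousLinearMap.toSpanSingleton ℝ (c • χ k))
        exact h
    exact this
  refine ⟨K, hK, fun p hp => ?_⟩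
  have hcl : IsClosed {p : L2 P × L2Vec P | ‖p.1 - K p.1‖ ≤ δ * ‖p.2‖} :=
    isClosed_le (by fun_prop) (by fun_prop)
  refine closure_minimal ?_ hcl hp
  intro q hq
  obtain ⟨φ, hφ, hcs, hsupp, hw, hG⟩ := hq
  have hφz : ∀ x, x ∉ P.Ω → φ x = 0 := fun x hx => by
    by_contra h
    exact hx (hsupp (subset_tsupport _ h))
  have hgz : ∀ x, x ∉ P.Ω → gradient φ x = 0 := fun x hx => by
    have : fderiv ℝ φ x = 0 := by
      by_contra h
      exact hx (hsupp (support_fderiv_subset ℝ h))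
    simp [gradient, this]
  -- The inner product only sees the part of the cell inside `Ω`, but `φ` vanishes outside, so the
  -- average over the whole cell is obtained even at the boundary.
  have hin : ∀ k, inner ℝ (χ k) q.1 = ∫ y in gridCell ε k, φ y := fun k => by
    rw [L2.inner_indicatorConstLp_one]
    rw [integral_congr_ae (ae_restrict_of_ae hw),
      Measure.restrict_restrict (volume_gridCell ε k).1, inter_comm,
      ← Measure.restrict_restrict P.isOpen.measurableSet]
    exact setIntegral_eq_integral_of_forall_compl_eq_zero hφz
  have hKq : K q.1 = ∑ k ∈ S, (c * ∫ y in gridCell ε k, φ y) • χ k := by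
    simp only [K, sum_apply, ContinuousLinearMap.comp_apply,
      ContinuousLinearMap.toSpanSingleton_apply, innerSL_apply_apply, hin, smul_smul, mul_comm c]
  have hsum : ∀ (a : (Fin n → ℤ) → ℝ) (S : Finset (Fin n → ℤ)),
      ⇑(∑ k ∈ S, a k • χ k) =ᵐ[volume.restrict P.Ω]
        fun x => ∑ k ∈ S, a k * (gridCell ε k).indicator (fun _ => (1 : ℝ)) x := by
    intro a S
    induction S using Finset.induction_on with
    | empty =>
      simp only [Finset.sum_empty]
      exact Lp.coeFn_zero _ _ _
    | insert k S hk ih =>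
      rw [Finset.sum_insert hk]
      filter_upwards [Lp.coeFn_add (a k • χ k) (∑ k ∈ S, a k • χ k), Lp.coeFn_smul (a k) (χ k),
        ih, indicatorConstLp_coeFn (p := 2) (hs := (volume_gridCell ε k).1)
          (hμs := measure_ne_top (volume.restrict P.Ω) _) (c := (1 : ℝ))] with x h1 h2 h3 h4
      rw [h1, Pi.add_apply, h2, Pi.smul_apply, h3, Finset.sum_insert hk, smul_eq_mul, h4]
  have hae : ∀ᵐ x ∂volume.restrict P.Ω, (q.1 - K q.1 : L2 P) x =
      φ x - c * ∫ y in gridCell ε (gridIndex ε x), φ y := by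
    rw [hKq]
    filter_upwards [Lp.coeFn_sub q.1 (∑ k ∈ S, (c * ∫ y in gridCell ε k, φ y) • χ k),
      hsum (fun k => c * ∫ y in gridCell ε k, φ y) S, hw,
      ae_restrict_mem P.isOpen.measurableSet] with x h1 h2 h3 hx
    rw [h1, Pi.sub_apply, h2, h3, Finset.sum_eq_single (gridIndex ε x)]
    · rw [indicator_of_mem ((mem_gridCell_iff hε).mpr rfl), mul_one]
    · intro k _ hk
      rw [indicator_of_notMem (fun h => hk ((mem_gridCell_iff hε).mp h).symm), mul_zero]
    · intro h
      exact absurd (gridIndex_mem_Icc hε (hΩ x hx)) h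
  have hDv := volume_setOf_forall_mem (fun _ : Fin n => Icc (-ε) ε) fun _ => measurableSet_Icc
  have hV0 : ENNReal.ofReal ε ^ n ≠ 0 := pow_ne_zero _ (ENNReal.ofReal_pos.mpr hε).ne'
  have hVtop : ENNReal.ofReal ε ^ n ≠ ⊤ := ENNReal.pow_ne_top ENNReal.ofReal_ne_top
  have main := lintegral_sub_average_sq_le hφ hcs
    (Q := fun x => gridCell ε (gridIndex ε x)) (V := ENNReal.ofReal ε ^ n)
    (D := {x : EuclideanSpace ℝ (Fin n) | ∀ i, x i ∈ Icc (-ε) ε}) (r := √n * ε)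
    (fun x => (volume_gridCell ε _).1) (fun x => (volume_gridCell ε _).2) hV0 hVtop hDv.1
    (fun x y hy i => by
      have h1 := hy i
      have h2 := (mem_gridCell_iff hε).mpr (rfl : gridIndex ε x = gridIndex ε x) i
      rw [mem_Ico] at h1 h2
      rw [PiLp.sub_apply, mem_Icc]
      constructor <;> linarith [h1.1, h1.2, h2.1, h2.2])
    (fun h hh => by
      refine (abs_le_of_sq_le_sq' ?_ (by positivity)).2
      rw [EuclideanSpace.norm_sq_eq, mul_pow, Real.sq_sqrt (by positivity)]
      calc ∑ i, ‖h i‖ ^ 2 ≤ ∑ _i : Fin n, ε ^ 2 := by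
            refine Finset.sum_le_sum fun i _ => ?_
            have : |h i| ≤ ε := abs_le.mpr (hh i)
            rw [Real.norm_eq_abs]
            gcongr
        _ = n * ε ^ 2 := by simp)
  have hDV : (ENNReal.ofReal ε ^ n)⁻¹ *
      volume {x : EuclideanSpace ℝ (Fin n) | ∀ i, x i ∈ Icc (-ε) ε} = ENNReal.ofReal (2 ^ n) := by
    rw [hDv.2]
    simp only [Real.volume_Icc, Finset.prod_const, Finset.card_univ, Fintype.card_fin]
    rw [show ε - -ε = 2 * ε by ring, ENNReal.ofReal_mul (by norm_num), mul_pow, mul_left_comm,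
      ENNReal.inv_mul_cancel hV0 hVtop, mul_one, ENNReal.ofReal_pow (by norm_num)]
  rw [hDV, mul_pow, Real.sq_sqrt (by positivity), ← ENNReal.ofReal_mul (by positivity)] at main
  have hGn : ENNReal.ofReal (‖q.2‖ ^ 2) = ∫⁻ x, ENNReal.ofReal (‖gradient φ x‖ ^ 2) := by
    rw [ofReal_norm_sq_eq_lintegral]
    have e1 : ∫⁻ x in P.Ω, ENNReal.ofReal (‖q.2 x‖ ^ 2) =
        ∫⁻ x in P.Ω, ENNReal.ofReal (‖gradient φ x‖ ^ 2) :=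
      lintegral_congr_ae (by filter_upwards [hG] with x hx; rw [hx])
    rw [e1, ← lintegral_indicator P.isOpen.measurableSet]
    refine lintegral_congr fun x => ?_
    by_cases hx : x ∈ P.Ω
    · rw [indicator_of_mem hx]
    · rw [indicator_of_notMem hx, hgz x hx]
      simp
  have hLn : ENNReal.ofReal (‖q.1 - K q.1‖ ^ 2) ≤
      ∫⁻ x, ENNReal.ofReal ((φ x - c * ∫ y in gridCell ε (gridIndex ε x), φ y) ^ 2) := by
    rw [ofReal_norm_sq_eq_lintegral]
    refine (le_of_eq (lintegral_congr_ae ?_)).trans (setLIntegral_le_lintegral P.Ω _)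
    filter_upwards [hae] with x hx
    rw [hx, Real.norm_eq_abs, sq_abs]
  have hfinal := hLn.trans main
  have hpos : 0 ≤ 2 ^ n * (n * ε ^ 2) * ‖q.2‖ ^ 2 := by positivity
  rw [← hGn, ← ENNReal.ofReal_mul (by positivity), ENNReal.ofReal_le_ofReal_iff hpos] at hfinal
  have hpos' : 0 ≤ δ * ‖q.2‖ := by positivity
  refine (abs_le_of_sq_le_sq' ?_ hpos').2
  rw [mul_pow]
  exact hfinal.trans (mul_le_mul_of_nonneg_right hεδ (sq_nonneg _))

/-! ### Diagonalization of compact symmetric operators -/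

section Spectral

variable {H : Type*} [NormedAddCommGroup H] [InnerProductSpace ℝ H]

/-- Distinct members are at distance `√2`, so balls of radius `1/2` around them are disjoint open
sets in a separable space. -/
theorem countable_of_orthonormal [TopologicalSpace.SeparableSpace H] {ι : Type*} {e : ι → H}
    (he : Orthonormal ℝ e) : Countable ι := by
  refine Pairwise.countable_of_isOpen_disjoint (s := fun i => Metric.ball (e i) (1 / 2)) ?_
    (fun i => Metric.isOpen_ball) fun i => Metric.nonempty_ball.mpr (by norm_num)
  intro i j hij
  refine Metric.ball_disjoint_ball ?_
  have h : ‖e i - e j‖ ^ 2 = 2 := by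
    rw [norm_sub_sq_real, he.1 i, he.1 j, he.2 hij]
    norm_num
  rw [dist_eq_norm]
  nlinarith [norm_nonneg (e i - e j)]

/-- Compact operators form a closed set in the operator norm. -/
theorem isCompactOperator_of_forall_approx {X Y : Type*} [NormedAddCommGroup X] [NormedSpace ℝ X]
    [NormedAddCommGroup Y] [NormedSpace ℝ Y] [CompleteSpace Y] {J : X →L[ℝ] Y}
    (h : ∀ δ > 0, ∃ K : X →L[ℝ] Y, IsCompactOperator K ∧ ∀ x, ‖J x - K x‖ ≤ δ * ‖x‖) :
    IsCompactOperator J := by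
  have hcl := isClosed_setOfPred_isCompactOperator (σ₁₂ := RingHom.id ℝ) (M₁ := X) (M₂ := Y)
  have hmem : J ∈ closure {F : X →L[ℝ] Y | IsCompactOperator F} := by
    rw [Metric.mem_closure_iff]
    intro δ hδ
    obtain ⟨K, hK, hb⟩ := h (δ / 2) (half_pos hδ)
    refine ⟨K, hK, ?_⟩
    rw [dist_eq_norm]
    exact (ContinuousLinearMap.opNorm_le_bound _ (half_pos hδ).le hb).trans_lt (half_lt_self hδ)
  rw [hcl.closure_eq] at hmem
  exact hmem

/-- Choose a Hilbert basis of every eigenspace, over all real `μ` and including the kernel, and take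
their union. It is orthonormal as the eigenspaces are mutually orthogonal, and complete by the
spectral theorem for compact symmetric operators. Separability makes the index type countable and
the dimension makes it infinite, so it can be relabelled by `ℕ`. -/
theorem exists_hilbertBasis_eigenvectors [CompleteSpace H] [TopologicalSpace.SeparableSpace H]
    (hdim : ¬FiniteDimensional ℝ H) {S : H →L[ℝ] H} (hc : IsCompactOperator S)
    (hs : S.IsSymmetric) :
    ∃ (b : HilbertBasis ℕ ℝ H) (μ : ℕ → ℝ), ∀ k, S (b k) = μ k • b k := by
  let G : ℝ → Submodule ℝ H := fun μ => Module.End.eigenspace (S : Module.End ℝ H) μ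
  have hmem : ∀ μ x, x ∈ G μ ↔ S x = μ • x := fun μ x => Module.End.mem_eigenspace_iff
  have hG : ∀ μ, IsClosed (G μ : Set H) := fun μ => by
    have e : (G μ : Set H) = {x | S x = μ • x} := by
      ext x
      exact hmem μ x
    rw [e]
    exact isClosed_eq S.continuous (continuous_const_smul μ)
  have hGc : ∀ μ, CompleteSpace (G μ) := fun μ => (hG μ).completeSpace_coe
  have hex : ∀ μ, ∃ w : Set (G μ), Nonempty (HilbertBasis w ℝ (G μ)) := fun μ => by
    obtain ⟨w, b, -⟩ := exists_hilbertBasis ℝ (G μ)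
    exact ⟨w, ⟨b⟩⟩
  choose w b using hex
  let d := fun μ => (b μ).some
  let e : (Σ μ, w μ) → H := fun a => (d a.1 a.2 : H)
  have he : Orthonormal ℝ e :=
    hs.orthogonalFamily_eigenspaces.orthonormal_sigma_orthonormal fun μ => (d μ).orthonormal
  have hspan : (Submodule.span ℝ (range e))ᗮ = ⊥ := by
    rw [eq_bot_iff, ← ContinuousLinearMap.orthogonalComplement_iSup_eigenspaces_eq_bot hc hs,
      ← Submodule.iInf_orthogonal]
    intro x hx
    rw [Submodule.mem_iInf]
    intro μ
    rw [Submodule.mem_orthogonal']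
    intro y hy
    have h1 := ((d μ).hasSum_repr ⟨y, hy⟩).mapL ((innerSL ℝ x : H →L[ℝ] ℝ).comp (G μ).subtypeL)
    have h2 : ∀ i, ((innerSL ℝ x : H →L[ℝ] ℝ).comp (G μ).subtypeL)
        ((d μ).repr ⟨y, hy⟩ i • d μ i) = 0 := fun i => by
      have : inner ℝ x (d μ i : H) = 0 :=
        (Submodule.mem_orthogonal' _ x).mp hx _ (Submodule.subset_span ⟨⟨μ, i⟩, rfl⟩)
      rw [map_smul]
      simp [this]
    simp only [h2] at h1
    exact h1.unique hasSum_zero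
  have : Countable (Σ μ, w μ) := countable_of_orthonormal he
  have : Infinite (Σ μ, w μ) := by
    by_contra hfin
    rw [not_infinite_iff_finite] at hfin
    have := Fintype.ofFinite (Σ μ, w μ)
    exact hdim ((HilbertBasis.mkOfOrthogonalEqBot he hspan).toOrthonormalBasis.toBasis
      |>.finiteDimensional_of_finite)
  obtain ⟨hden⟩ := nonempty_denumerable (Σ μ, w μ)
  let q : ℕ ≃ (Σ μ, w μ) := (Denumerable.eqv _).symm
  refine ⟨HilbertBasis.mkOfOrthogonalEqBot (v := e ∘ q) (he.comp q q.injective) ?_,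
    fun k => (q k).1, fun k => ?_⟩
  · rwa [q.surjective.range_comp]
  · rw [HilbertBasis.coe_mkOfOrthogonalEqBot]
    exact (hmem _ _).mp (d (q k).1 (q k).2).2

end Spectral

/-! ### The space `H¹₀(Ω)` and the form of `𝓛` -/

section Form

variable (P : EllipticOperator n)

theorem isFiniteMeasure_restrict : IsFiniteMeasure (volume.restrict P.Ω) := ⟨by
  rw [Measure.restrict_apply_univ]
  exact P.bounded.measure_lt_top⟩

/-- The pairs `(φ, ∇φ)`, `φ ∈ C_c^∞(Ω)`, as a subspace. -/
def testSub : Submodule ℝ (L2 P × L2Vec P) where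
  carrier := testPairs P
  zero_mem' := by
    refine ⟨fun _ => 0, contDiff_const, HasCompactSupport.zero, by simp [tsupport], ?_, ?_⟩
    · exact Lp.coeFn_zero _ _ _
    · have : gradient (fun _ : EuclideanSpace ℝ (Fin n) => (0 : ℝ)) = fun _ => 0 := by
        funext x
        simp [gradient]
      rw [this]
      exact Lp.coeFn_zero _ _ _
  add_mem' := by
    rintro p q ⟨φ, h1, h2, h3, h4, h5⟩ ⟨ψ, k1, k2, k3, k4, k5⟩
    refine ⟨fun x => φ x + ψ x, h1.add k1, h2.add k2,
      (tsupport_add _ _).trans (union_subset h3 k3), ?_, ?_⟩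
    · filter_upwards [Lp.coeFn_add p.1 q.1, h4, k4] with x e1 e2 e3
      rw [Prod.fst_add, e1, Pi.add_apply, e2, e3]
    · filter_upwards [Lp.coeFn_add p.2 q.2, h5, k5] with x e1 e2 e3
      rw [Prod.snd_add, e1, Pi.add_apply, e2, e3, gradient, gradient, gradient, ← map_add,
        ← fderiv_add ((h1.differentiable (by simp)) x) ((k1.differentiable (by simp)) x)]
      rfl
  smul_mem' := by
    rintro a p ⟨φ, h1, h2, h3, h4, h5⟩
    refine ⟨fun x => a * φ x, contDiff_const.mul h1, h2.mul_left, ?_, ?_, ?_⟩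
    · refine (closure_mono ?_).trans h3
      intro x hx hx0
      exact hx (by simp [hx0])
    · filter_upwards [Lp.coeFn_smul a p.1, h4] with x e1 e2
      rw [Prod.smul_fst, e1, Pi.smul_apply, e2, smul_eq_mul]
    · filter_upwards [Lp.coeFn_smul a p.2, h5] with x e1 e2
      rw [Prod.smul_snd, e1, Pi.smul_apply, e2, gradient, gradient,
        fderiv_const_mul ((h1.differentiable (by simp)) x), map_smulₛₗ]
      rfl

/-- `H¹₀(Ω)` as a closed subspace of the Hilbert space `L²(Ω) × L²(Ω; ℝⁿ)`. -/
def H10Sub : Submodule ℝ (WithLp 2 (L2 P × L2Vec P)) :=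
  (testSub P).topologicalClosure.comap
    (WithLp.prodContinuousLinearEquiv 2 ℝ (L2 P) (L2Vec P) : _ →ₗ[ℝ] L2 P × L2Vec P)

theorem mem_H10Sub {p : WithLp 2 (L2 P × L2Vec P)} :
    p ∈ H10Sub P ↔ (p.fst, p.snd) ∈ H10 P := Iff.rfl

theorem isClosed_H10Sub : IsClosed (H10Sub P : Set (WithLp 2 (L2 P × L2Vec P))) :=
  (testSub P).isClosed_topologicalClosure.preimage
    (WithLp.prodContinuousLinearEquiv 2 ℝ (L2 P) (L2Vec P)).continuous

instance : CompleteSpace (H10Sub P) := (isClosed_H10Sub P).completeSpace_coe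

/-- The inclusion of `H¹₀(Ω)` in `L²(Ω)`. -/
def H10Incl : H10Sub P →L[ℝ] L2 P := (WithLp.fstL 2 ℝ (L2 P) (L2Vec P)).comp (H10Sub P).subtypeL

/-- Rellich's theorem. -/
theorem isCompactOperator_H10Incl : IsCompactOperator (H10Incl P) := by
  refine isCompactOperator_of_forall_approx fun δ hδ => ?_
  obtain ⟨K, hK, hb⟩ := exists_isCompactOperator_approx P hδ
  refine ⟨K.comp (H10Incl P), hK.comp_clm (H10Incl P), fun p => ?_⟩
  have h1 := hb _ ((mem_H10Sub P).mp p.2)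
  have h2 : ‖p.1.snd‖ ≤ ‖p‖ := by
    refine (abs_le_of_sq_le_sq' ?_ (norm_nonneg _)).2
    have h3 : ‖p‖ ^ 2 = ‖p.1.fst‖ ^ 2 + ‖p.1.snd‖ ^ 2 := WithLp.prod_norm_sq_eq_of_L2 p.1
    rw [h3]
    nlinarith [sq_nonneg ‖p.1.fst‖]
  exact h1.trans (mul_le_mul_of_nonneg_left h2 hδ.le)

/-- A Lipschitz function on a bounded set is bounded. Summing the entries at the base point gives
one constant for all `i` and `j`. -/
theorem exists_bound_coeff : ∃ M, 0 ≤ M ∧ ∀ x ∈ P.Ω, ∀ i j, |P.A x i j| ≤ M := by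
  obtain ⟨L, hL⟩ := P.lipschitz
  obtain ⟨x₀, hx₀⟩ := P.nonempty
  obtain ⟨D, hD0, hD⟩ := P.bounded.exists_pos_norm_le
  refine ⟨(∑ i, ∑ j, |P.A x₀ i j|) + L * (D + D), by positivity, fun x hx i j => ?_⟩
  have h1 := (hL i j).norm_sub_le hx hx₀
  have h2 : ‖x - x₀‖ ≤ D + D := (norm_sub_le _ _).trans (add_le_add (hD x hx) (hD x₀ hx₀))
  have h3 := norm_le_norm_add_norm_sub' (P.A x i j) (P.A x₀ i j)
  have h4 := mul_le_mul_of_nonneg_left h2 L.2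
  have h5 : |P.A x₀ i j| ≤ ∑ i, ∑ j, |P.A x₀ i j| :=
    (Finset.single_le_sum (f := fun j => |P.A x₀ i j|) (fun _ _ => abs_nonneg _)
      (Finset.mem_univ j)).trans
    (Finset.single_le_sum (f := fun i => ∑ j, |P.A x₀ i j|)
      (fun _ _ => Finset.sum_nonneg fun _ _ => abs_nonneg _) (Finset.mem_univ i))
  exact h3.trans (add_le_add h5 (h1.trans h4))

theorem memLp_top_coeff (i j : Fin n) :
    MemLp (fun x => P.A x i j) ⊤ (volume.restrict P.Ω) := by
  obtain ⟨L, hL⟩ := P.lipschitz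
  obtain ⟨M, _, hM⟩ := exists_bound_coeff P
  refine memLp_top_of_bound ((hL i j).continuousOn.aestronglyMeasurable P.isOpen.measurableSet)
    M ?_
  filter_upwards [ae_restrict_mem P.isOpen.measurableSet] with x hx
  exact hM x hx i j

theorem integrable_form (p q : L2 P × L2Vec P) :
    Integrable (fun x => (∑ i, ∑ j, P.A x i j * p.2 x j * q.2 x i) + P.c x * p.1 x * q.1 x)
      (volume.restrict P.Ω) := by
  have hcomp : ∀ (G : L2Vec P) i, MemLp (fun x => G x i) 2 (volume.restrict P.Ω) := fun G i =>
    (EuclideanSpace.proj (𝕜 := ℝ) i).comp_memLp' (Lp.memLp G)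
  refine Integrable.add ?_ ?_
  · refine integrable_finsetSum _ fun i _ => integrable_finsetSum _ fun j _ => ?_
    have h1 : MemLp (fun x => P.A x i j * p.2 x j) 2 (volume.restrict P.Ω) :=
      (hcomp p.2 j).mul (memLp_top_coeff P i j)
    exact h1.integrable_mul (hcomp q.2 i)
  · have h1 : MemLp (fun x => P.c x * p.1 x) 2 (volume.restrict P.Ω) :=
      (Lp.memLp p.1).mul P.c_memLp
    exact h1.integrable_mul (Lp.memLp q.1)

theorem form_comm (p q : L2 P × L2Vec P) : form P p q = form P q p := by
  refine integral_congr_ae ?_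
  filter_upwards [ae_restrict_mem P.isOpen.measurableSet] with x hx
  rw [Finset.sum_comm]
  congr 1
  · refine Finset.sum_congr rfl fun i _ => Finset.sum_congr rfl fun j _ => ?_
    rw [(P.symmetric x hx).apply i j]
    ring
  · ring

theorem form_add_left (p p' q : L2 P × L2Vec P) :
    form P (p + p') q = form P p q + form P p' q := by
  rw [form, form, form, ← integral_add (integrable_form P p q) (integrable_form P p' q)]
  refine integral_congr_ae ?_
  filter_upwards [Lp.coeFn_add p.1 p'.1, Lp.coeFn_add p.2 p'.2] with x h1 h2
  simp only [Prod.fst_add, Prod.snd_add, h1, h2, Pi.add_apply, PiLp.add_apply, mul_add, add_mul,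
    Finset.sum_add_distrib]
  ring

theorem form_smul_left (a : ℝ) (p q : L2 P × L2Vec P) :
    form P (a • p) q = a * form P p q := by
  rw [form, form, ← integral_const_mul]
  refine integral_congr_ae ?_
  filter_upwards [Lp.coeFn_smul a p.1, Lp.coeFn_smul a p.2] with x h1 h2
  simp only [Prod.smul_fst, Prod.smul_snd, h1, h2, Pi.smul_apply, PiLp.smul_apply, smul_eq_mul,
    mul_add, Finset.mul_sum]
  congr 1
  · refine Finset.sum_congr rfl fun i _ => Finset.sum_congr rfl fun j _ => ?_
    ring
  · ring

theorem integral_norm_mul_norm_le {α F F' : Type*} [MeasurableSpace α] {μ : Measure α}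
    [NormedAddCommGroup F] [NormedAddCommGroup F'] (u : Lp F 2 μ) (v : Lp F' 2 μ) :
    Integrable (fun x => ‖u x‖ * ‖v x‖) μ ∧ ∫ x, ‖u x‖ * ‖v x‖ ∂μ ≤ ‖u‖ * ‖v‖ := by
  have hu := (Lp.memLp u).norm
  have hv := (Lp.memLp v).norm
  refine ⟨hu.integrable_mul hv, ?_⟩
  have h := real_inner_le_norm (hu.toLp _) (hv.toLp _)
  rw [Lp.norm_toLp, Lp.norm_toLp, eLpNorm_norm, eLpNorm_norm, ← Lp.norm_def, ← Lp.norm_def,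
    L2.inner_def] at h
  refine le_trans (le_of_eq (integral_congr_ae ?_)) h
  filter_upwards [hu.coeFn_toLp, hv.coeFn_toLp] with x h1 h2
  rw [h1, h2]
  simp [mul_comm]

theorem exists_form_bound : ∃ C, 0 ≤ C ∧ ∀ p q : L2 P × L2Vec P,
    |form P p q| ≤ C * (‖p.2‖ * ‖q.2‖ + ‖p.1‖ * ‖q.1‖) := by
  obtain ⟨M, hM0, hM⟩ := exists_bound_coeff P
  obtain ⟨N, hN0, hN⟩ : ∃ N, 0 ≤ N ∧ ∀ᵐ x ∂volume.restrict P.Ω, |P.c x| ≤ N := by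
    refine ⟨(eLpNorm P.c ⊤ (volume.restrict P.Ω)).toReal, ENNReal.toReal_nonneg, ?_⟩
    have h := P.c_memLp.2
    rw [eLpNorm_exponent_top] at h ⊢
    filter_upwards [ae_le_eLpNormEssSup (f := P.c) (μ := volume.restrict P.Ω)] with x hx
    have := ENNReal.toReal_mono h.ne hx
    simpa using this
  refine ⟨n * (n * M) + N, by positivity, fun p q => ?_⟩
  obtain ⟨i1, b1⟩ := integral_norm_mul_norm_le p.2 q.2
  obtain ⟨i2, b2⟩ := integral_norm_mul_norm_le p.1 q.1
  have hle : |form P p q| ≤ ∫ x in P.Ω, (n * (n * M) * (‖p.2 x‖ * ‖q.2 x‖) +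
      N * (‖p.1 x‖ * ‖q.1 x‖)) := by
    refine (abs_integral_le_integral_abs).trans
      (integral_mono_ae (integrable_form P p q).abs ((i1.const_mul _).add (i2.const_mul _)) ?_)
    filter_upwards [ae_restrict_mem P.isOpen.measurableSet, hN] with x hx hNx
    refine (abs_add_le _ _).trans (add_le_add ?_ ?_)
    · have h1 : ∀ i j, |P.A x i j * p.2 x j * q.2 x i| ≤ M * (‖p.2 x‖ * ‖q.2 x‖) := fun i j => by
        have a1 : |p.2 x j| ≤ ‖p.2 x‖ := PiLp.norm_apply_le (p.2 x) j
        have a2 : |q.2 x i| ≤ ‖q.2 x‖ := PiLp.norm_apply_le (q.2 x) i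
        have a3 := hM x hx i j
        rw [abs_mul, abs_mul, mul_assoc]
        gcongr
      calc |∑ i, ∑ j, P.A x i j * p.2 x j * q.2 x i|
          ≤ ∑ _i : Fin n, ∑ _j : Fin n, M * (‖p.2 x‖ * ‖q.2 x‖) :=
            (Finset.abs_sum_le_sum_abs _ _).trans (Finset.sum_le_sum fun i _ =>
              (Finset.abs_sum_le_sum_abs _ _).trans (Finset.sum_le_sum fun j _ => h1 i j))
        _ = n * (n * M) * (‖p.2 x‖ * ‖q.2 x‖) := by
            simp
            ring
    · rw [abs_mul, abs_mul, mul_assoc]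
      exact mul_le_mul_of_nonneg_right hNx (by positivity)
  rw [integral_add (i1.const_mul _) (i2.const_mul _), integral_const_mul, integral_const_mul] at hle
  have c1 : 0 ≤ (n : ℝ) * (n * M) := by positivity
  have c2 := mul_le_mul_of_nonneg_left b1 c1
  have c3 := mul_le_mul_of_nonneg_left b2 hN0
  have c4 : 0 ≤ (n : ℝ) * (n * M) * (‖p.1‖ * ‖q.1‖) := by positivity
  have c5 : 0 ≤ N * (‖p.2‖ * ‖q.2‖) := by positivity
  linarith

/-- The form of `𝓛` is a bounded bilinear form on `H¹₀(Ω)`. -/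
theorem exists_formL : ∃ a : H10Sub P →L[ℝ] H10Sub P →L[ℝ] ℝ,
    ∀ p q : H10Sub P, a p q = form P (p.1.fst, p.1.snd) (q.1.fst, q.1.snd) := by
  obtain ⟨C, hC0, hC⟩ := exists_form_bound P
  refine ⟨LinearMap.mkContinuous₂ (LinearMap.mk₂ ℝ
    (fun p q : H10Sub P => form P (p.1.fst, p.1.snd) (q.1.fst, q.1.snd))
    (fun p p' q => form_add_left P (p.1.fst, p.1.snd) (p'.1.fst, p'.1.snd) _)
    (fun a p q => form_smul_left P a (p.1.fst, p.1.snd) _)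
    (fun p q q' => ?_) (fun a p q => ?_)) (C * 2) (fun p q => ?_), fun p q => rfl⟩
  · rw [form_comm, form_comm P _ (q.1.fst, q.1.snd), form_comm P _ (q'.1.fst, q'.1.snd)]
    exact form_add_left P (q.1.fst, q.1.snd) (q'.1.fst, q'.1.snd) _
  · rw [form_comm, form_comm P _ (q.1.fst, q.1.snd)]
    exact form_smul_left P a (q.1.fst, q.1.snd) _
  · have hn : ∀ p : H10Sub P, ‖p.1.fst‖ ≤ ‖p‖ ∧ ‖p.1.snd‖ ≤ ‖p‖ := fun p => by
      have h3 : ‖p‖ ^ 2 = ‖p.1.fst‖ ^ 2 + ‖p.1.snd‖ ^ 2 := WithLp.prod_norm_sq_eq_of_L2 p.1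
      constructor
      · refine (abs_le_of_sq_le_sq' ?_ (norm_nonneg _)).2
        nlinarith [sq_nonneg ‖p.1.snd‖]
      · refine (abs_le_of_sq_le_sq' ?_ (norm_nonneg _)).2
        nlinarith [sq_nonneg ‖p.1.fst‖]
    refine (hC _ _).trans ?_
    have h1 := mul_le_mul (hn p).1 (hn q).1 (norm_nonneg _) (norm_nonneg _)
    have h2 := mul_le_mul (hn p).2 (hn q).2 (norm_nonneg _) (norm_nonneg _)
    have h3 := mul_le_mul_of_nonneg_left (add_le_add h2 h1) hC0
    refine h3.trans (le_of_eq ?_)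
    ring

/-- Ellipticity controls only the gradient; Poincaré gives `‖p‖² ≤ (K + 1) ‖∇p‖²`, hence the
constant `α / (K + 1)`. -/
theorem isCoercive_of_eq_form {a : H10Sub P →L[ℝ] H10Sub P →L[ℝ] ℝ}
    (ha : ∀ p q : H10Sub P, a p q = form P (p.1.fst, p.1.snd) (q.1.fst, q.1.snd)) :
    IsCoercive a := by
  obtain ⟨K, hK, hP⟩ := poincare P
  obtain ⟨α, hα, hc⟩ := form_coercive P
  refine ⟨α / (K + 1), by positivity, fun p => ?_⟩
  have h1 := hP _ ((mem_H10Sub P).mp p.2)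
  have h2 := hc (p.1.fst, p.1.snd)
  have h3 : ‖p‖ ^ 2 = ‖p.1.fst‖ ^ 2 + ‖p.1.snd‖ ^ 2 := WithLp.prod_norm_sq_eq_of_L2 p.1
  rw [ha]
  refine le_trans ?_ h2
  rw [mul_assoc, ← sq, h3, div_mul_eq_mul_div, div_le_iff₀ (by positivity)]
  simp only at h1
  nlinarith

/-! ### Existence of the eigenbasis -/

/-- `C_c^∞(Ω)` is dense in `L²(Ω)`. -/
theorem eq_zero_of_forall_inner_H10 {f : L2 P} (hf : ∀ q ∈ H10 P, inner ℝ f q.1 = 0) : f = 0 := by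
  have := isFiniteMeasure_restrict P
  have hfi : Integrable f (volume.restrict P.Ω) := (Lp.memLp f).integrable (by norm_num)
  have hae := P.isOpen.ae_eq_zero_of_integral_contDiff_smul_eq_zero (f := f) (μ := volume)
    (IntegrableOn.locallyIntegrableOn hfi) fun φ hφ hc hs => by
      have m1 : MemLp φ 2 (volume.restrict P.Ω) := hφ.continuous.memLp_of_hasCompactSupport hc
      have hgs : HasCompactSupport (gradient φ) :=
        (hc.fderiv (𝕜 := ℝ)).comp_left (g := (InnerProductSpace.toDual ℝ _).symm) (map_zero _)
      have m2 : MemLp (gradient φ) 2 (volume.restrict P.Ω) :=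
        (continuous_gradient hφ).memLp_of_hasCompactSupport hgs
      have h := hf (m1.toLp φ, m2.toLp _)
        (subset_closure ⟨φ, hφ, hc, hs, m1.coeFn_toLp, m2.coeFn_toLp⟩)
      rw [L2.inner_def] at h
      have e : ∫ x, φ x • f x = ∫ x in P.Ω, φ x • f x :=
        (setIntegral_eq_integral_of_forall_compl_eq_zero fun x hx => by
          have : φ x = 0 := by
            by_contra hne
            exact hx (hs (subset_tsupport _ hne))
          rw [this, zero_smul]).symm
      rw [e, ← h]
      refine integral_congr_ae ?_
      filter_upwards [m1.coeFn_toLp] with x hx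
      simp [hx]
  refine Lp.ext ?_
  have h0 : f =ᵐ[volume.restrict P.Ω] fun _ => 0 := by
    rw [EventuallyEq, ae_restrict_iff' P.isOpen.measurableSet]
    exact hae
  exact h0.trans (Lp.coeFn_zero _ _ _).symm

/-- Since `n ≥ 1`, the open set `Ω` is infinite and so contains infinitely many disjoint nonempty
open subsets; their indicators are orthogonal and nonzero. This is what allows the eigenbasis to be
indexed by all of `ℕ`. -/
theorem not_finiteDimensional_L2 : ¬FiniteDimensional ℝ (L2 P) := by
  intro hfd
  have := isFiniteMeasure_restrict P
  have : Nonempty (Fin n) := ⟨⟨0, P.one_le_dim⟩⟩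
  have hinf : P.Ω.Infinite := by
    obtain ⟨x, hx⟩ := P.nonempty
    have := Module.punctured_nhds_neBot ℝ (EuclideanSpace ℝ (Fin n)) x
    exact infinite_of_mem_nhds x (P.isOpen.mem_nhds hx)
  have : Infinite P.Ω := hinf.to_subtype
  obtain ⟨U, hUi, hUo, hUd⟩ := exists_seq_infinite_isOpen_pairwise_disjoint P.Ω
  let W : ℕ → Set (EuclideanSpace ℝ (Fin n)) := fun k => Subtype.val '' U k
  have hWo : ∀ k, IsOpen (W k) := fun k => P.isOpen.isOpenMap_subtype_val _ (hUo k)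
  have hWm := fun k => (hWo k).measurableSet
  have hWd : Pairwise (Function.onFun Disjoint W) := fun i j hij =>
    (disjoint_image_iff Subtype.val_injective).mpr (hUd hij)
  have hWp : ∀ k, 0 < (volume.restrict P.Ω).real (W k) := fun k => by
    refine ENNReal.toReal_pos ?_ (measure_ne_top _ _)
    rw [Measure.restrict_apply (hWm k), inter_eq_left.mpr (by
      rintro _ ⟨x, _, rfl⟩
      exact x.2)]
    exact ((hWo k).measure_pos volume ((hUi k).nonempty.image _)).ne'
  let χ : ℕ → L2 P := fun k => indicatorConstLp 2 (hWm k) (measure_ne_top _ _) (1 : ℝ)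
  have hin : ∀ i j, inner ℝ (χ i) (χ j) = (volume.restrict P.Ω).real (W j ∩ W i) := fun i j => by
    rw [L2.inner_indicatorConstLp_one, setIntegral_indicatorConstLp (hWm i), smul_eq_mul, mul_one]
  have hli : LinearIndependent ℝ χ := by
    refine linearIndependent_of_ne_zero_of_inner_eq_zero (𝕜 := ℝ) (fun k hk => ?_) fun i j hij => ?_
    · have h := hin k k
      rw [hk, inner_zero_left, inter_self] at h
      exact (hWp k).ne h
    · change inner ℝ (χ i) (χ j) = 0
      rw [hin, (hWd hij.symm).inter_eq, measureReal_empty]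
  have := hli.finite_of_isNoetherian
  exact not_finite ℕ

/-- Diagonalize the inverse of `𝓛`, a compact symmetric injective operator on `L²(Ω)`; its
eigenvectors are the eigenfunctions and its eigenvalues are inverted. -/
theorem nonempty_eigenbasis : Nonempty (Eigenbasis P) := by
  obtain ⟨a, ha⟩ := exists_formL P
  have hco := isCoercive_of_eq_form P ha
  let J := H10Incl P
  -- Lax–Milgram: the adjoint of the inclusion represents `q ↦ (f, q)` by an element of `H¹₀(Ω)`, to
  -- which the inverse of the operator of the form is applied.
  let R : L2 P →L[ℝ] H10Sub P :=
    (hco.continuousLinearEquivOfBilin.symm : H10Sub P →L[ℝ] H10Sub P).comp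
      (ContinuousLinearMap.adjoint J)
  have hR : ∀ f q, a (R f) q = inner ℝ f (J q) := fun f q => by
    rw [← hco.continuousLinearEquivOfBilin_apply, ← ContinuousLinearMap.adjoint_inner_left]
    congr 1
    exact hco.continuousLinearEquivOfBilin.apply_symm_apply _
  have hsym : ∀ p q, a p q = a q p := fun p q => by rw [ha, ha, form_comm]
  let S : L2 P →L[ℝ] L2 P := J.comp R
  have hSc : IsCompactOperator S := (isCompactOperator_H10Incl P).comp_clm R
  have hSs : S.IsSymmetric := fun f g => by
    change inner ℝ (J (R f)) g = inner ℝ f (J (R g))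
    rw [real_inner_comm, ← hR, ← hR, hsym]
  -- If `S f = 0`, the energy of `R f` is `(f, S f) = 0`, so `R f = 0` by coercivity. Then `f` is
  -- orthogonal to all of `H¹₀(Ω)`, hence zero.
  have hSi : ∀ f, S f = 0 → f = 0 := fun f hf => by
    have h1 : a (R f) (R f) = 0 := by
      rw [hR]
      change inner ℝ f (S f) = 0
      rw [hf, inner_zero_right]
    have h2 : R f = 0 := by
      obtain ⟨C, hC, hb⟩ := hco
      have := hb (R f)
      rw [h1, mul_assoc] at this
      have h3 : ‖R f‖ * ‖R f‖ ≤ 0 := by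
        by_contra hlt
        exact absurd this (not_le.mpr (mul_pos hC (not_le.mp hlt)))
      exact norm_eq_zero.mp (mul_self_eq_zero.mp (le_antisymm h3 (mul_self_nonneg _)))
    refine eq_zero_of_forall_inner_H10 P fun q hq => ?_
    have h4 := hR f ⟨WithLp.toLp 2 q, hq⟩
    rw [h2, map_zero] at h4
    exact h4.symm
  -- Needed to infer the separability of `L²(Ω)`.
  have : Fact ((2 : ℝ≥0∞) ≠ ⊤) := ⟨by simp⟩
  obtain ⟨b, μ, hb⟩ := exists_hilbertBasis_eigenvectors (not_finiteDimensional_L2 P) hSc hSs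
  have hb0 : ∀ k, b k ≠ 0 := fun k => b.orthonormal.ne_zero k
  -- From `S b = μ b` one gets `b = μ⁻¹ S b`, so `b` is the function component of `μ⁻¹ R b ∈
  -- H¹₀(Ω)`; the gradient component of the same pair is its weak gradient.
  refine ⟨⟨fun k => (μ k)⁻¹, b, fun k => ⟨hb0 k, ((μ k)⁻¹ • R (b k)).1.snd, ?_⟩⟩⟩
  have hμ : μ k ≠ 0 := fun h => hb0 k (hSi _ (by rw [hb, h, zero_smul]))
  have h1 : ((μ k)⁻¹ • R (b k)).1.fst = b k := by
    have : J ((μ k)⁻¹ • R (b k)) = b k := by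
      rw [map_smul]
      change (μ k)⁻¹ • S (b k) = b k
      rw [hb, smul_smul, inv_mul_cancel₀ hμ, one_smul]
    exact this
  have h2 := ((μ k)⁻¹ • R (b k)).2
  rw [mem_H10Sub, h1] at h2
  refine ⟨h2, fun q hq => ?_⟩
  have h3 := ha ((μ k)⁻¹ • R (b k)) ⟨WithLp.toLp 2 q, hq⟩
  rw [h1, map_smul, smul_apply, hR, smul_eq_mul] at h3
  exact h3.symm

end Form

end FracWave

end

open FracWave Eigenbasis.Hs in
theorem mainTheorem2 {n : ℕ} (P : EllipticOperator n) :
    Nonempty (Eigenbasis P) ∧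
    ∀ s : ℝ≥0, 0 < s → s < 1 → ∀ T : ℝ, 0 < T → ∃ C : ℝ, 0 < C ∧
      ∀ (B : Eigenbasis P) (f : Lp (L2 P) 2 (timeMeasure T)) (g : B.Hs s) (h : L2 P),
        (∃! u : Lp (B.Hs s) 2 (timeMeasure T), IsWeakSolution B s T f g h u) ∧
        ∀ (u : Lp (B.Hs s) 2 (timeMeasure T)) (u' : Lp (L2 P) 2 (timeMeasure T)),
          IsWeakSolution B s T f g h u →
          HasWeakTimeDeriv T (fun t => toL2 B s (u t)) u' →
          eLpNorm u ∞ (timeMeasure T) + eLpNorm u' ∞ (timeMeasure T) ≤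
            ENNReal.ofReal (C * (‖f‖ + ‖g‖ + ‖h‖)) := by
  -- The constant depends on `T` alone; in particular one constant serves every choice of
  -- eigenbasis.
  exact ⟨nonempty_eigenbasis P, fun _ _ _ T hT => ⟨4 * (1 + √T), by positivity,
    fun _ f g h => wave_wellPosed hT f g h⟩⟩
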